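/- Let $(U_k)_{k\ge 0}$ be i.i.d. uniform random variables on $[-1,1]$, realized as the coordinates of the canonical product probability space $\Omega$. For $n\ge 1$ let $\hat L^2(\mathbb R_+^n)$ be the space of symmetric square-integrable functions $f_n:\mathbb R_+^n\to\mathbb R$ that vanish (a.e.) outside of $$\Delta_n=\bigcup_{k_1,\dots,k_n\ge 0\ \text{pairwise distinct}}[2k_1,2k_1+2]\times\cdots\times[2k_n,2k_n+2].$$ For $f_n\in\hat L^2(\mathbb R_+^n)\cap L^1(\mathbb R_+^n)$ the multiple stochastic integral is $$I_n(f_n)=\sum_{r=0}^n\frac{(-1)^{n-r}}{2^{n-r}}\binom nr\sum_{k_1,\dots,k_r\ge 0\ \text{pairwise distinct}}\int_{\mathbb R_+^{n-r}}f_n(2k_1+1+U_{k_1},\dots,2k_r+1+U_{k_r},y_1,\dots,y_{n-r})\,dy_1\cdots dy_{n-r},$$ and it is extended to all $f_n\in\hat L^2(\mathbb R_+^n)$ by $L^2$-continuity: $I_n(f_n)$ is the limit in $L^2(\Omega)$ of $I_n(g_m)$ for $g_m\in\hat L^2(\mathbb R_+^n)\cap L^1(\mathbb R_+^n)$ with $g_m\to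 f_n$ in $L^2(\mathbb R_+^n)$; this limit exists and is almost surely unique. For a random variable $X$ on $\Omega$ and $t\ge 0$ put $$\nabla_tX=X\circ\Psi_t-\frac12\int_{2\lfloor t/2\rfloor}^{2\lfloor t/2\rfloor+2}X\circ\Psi_s\,ds,$$ where $\Psi_t:\Omega\to\Omega$ replaces the coordinate $U_{\lfloor t/2\rfloor}$ by $t-2\lfloor t/2\rfloor-1$ and keeps all the others. Let $d_W(X,\mathcal N)=\sup_h|E[h(X)]-E[h(N)]|$, where $N$ is standard normal and $h$ runs over the functions $\mathbb R\to\mathbb R$ with Lipschitz constant at most $1$. **Proposition.** Let $n\ge1$ and $f_n\in\hat L^2(\mathbb R_+^n)$. Then $t\mapsto\nabla_tI_n(f_n)$ is almost surely in $L^2(\mathbb R_+)$, and $$\begin{aligned}d_W(I_n(f_n),\mathcal N)\le{}&\sqrt{E\Big[\Big(1-\frac1n\|\nabla I_n(f_n)\|^2_{L^2(\mathbb R_+,dx/2)}\Big)^2\Big]}+\frac1{2n}E\Big[\int_0^\infty|\nabla_tI_n(f_n)|^3\,dt\Big]\\&+\frac1{4n}E\Big[\int_0^\infty|\nabla_tI_n(f_n)|\int_{2\lfloor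 t/2\rfloor}^{2\lfloor t/2\rfloor+2}|\nabla_sI_n(f_n)|^2\,ds\,dt\Big],\end{aligned}$$ where the terms on the right may be infinite. -/

import Mathlib

open MeasureTheory ProbabilityTheory Set Filter Topology
open scoped ENNReal NNReal

noncomputable section

namespace UniformSeq

/-- The canonical sample space: `ω k` is the value of the `k`-th variable `U_k`, `k = 0, 1, 2, …`. -/
abbrev Omega : Type := ℕ → ℝ

/-- The uniform probability law on `[-1, 1]`. -/
def unif : Measure ℝ := ProbabilityTheory.cond volume (Icc (-1 : ℝ) 1)

instance : IsProbabilityMeasure unif := by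
  unfold unif
  exact ProbabilityTheory.cond_isProbabilityMeasure_of_finite (by simp) (by simp)

/-- The law of an i.i.d. sequence of uniform random variables on `[-1, 1]`. -/
def prob : Measure Omega := Measure.infinitePi (fun _ : ℕ => unif)

/-- Lebesgue measure on `ℝ₊ = [0, ∞)`. -/
abbrev leb : Measure ℝ := volume.restrict (Ici (0 : ℝ))

/-- Lebesgue measure on `ℝ₊ⁿ`. -/
abbrev lebPi (n : ℕ) : Measure (Fin n → ℝ) := Measure.pi (fun _ : Fin n => leb)

/-- The set `Δ_n`: the union of the boxes `[2k₁, 2k₁+2] × ⋯ × [2kₙ, 2kₙ+2]` over pairwise distinct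
`k₁, …, kₙ ≥ 0`. -/
def Delta (n : ℕ) : Set (Fin n → ℝ) :=
  {x | ∃ k : Fin n ↪ ℕ, ∀ i, x i ∈ Icc (2 * (k i : ℝ)) (2 * (k i : ℝ) + 2)}

/-- (Representatives of) elements of the space of symmetric square-integrable functions on `ℝ₊ⁿ`
that vanish outside of `Δ_n`. -/
structure HatL2 (n : ℕ) (f : (Fin n → ℝ) → ℝ) : Prop where
  memLp : MemLp f 2 (lebPi n)
  symm : ∀ σ : Equiv.Perm (Fin n), (fun x => f (x ∘ σ)) =ᵐ[lebPi n] f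
  vanish : ∀ᵐ x ∂(lebPi n), x ∉ Delta n → f x = 0

/-- The point `(2k₁+1+U_{k₁}, …, 2k_r+1+U_{k_r}, y₁, …, y_{n-r})`. -/
def jumpPoint (n r : ℕ) (k : Fin r ↪ ℕ) (y : Fin (n - r) → ℝ) (ω : Omega) : Fin n → ℝ :=
  fun i =>
    if h : (i : ℕ) < r then 2 * (k ⟨i, h⟩ : ℝ) + 1 + ω (k ⟨i, h⟩)
    else y ⟨(i : ℕ) - r, by have := i.isLt; omega⟩

/-- The multiple stochastic integral of an integrable `f`, by its explicit formula
`∑_{r=0}^n (-1)^{n-r} / 2^{n-r} (n choose r) ∑_{k₁ ≠ ⋯ ≠ k_r}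
  ∫ ⋯ ∫ f (2k₁+1+U_{k₁}, …, 2k_r+1+U_{k_r}, y₁, …, y_{n-r}) dy`.
For integrable `f` the sum over the pairwise distinct `k₁, …, k_r` converges absolutely almost
surely. -/
def multIntL1 (n : ℕ) (f : (Fin n → ℝ) → ℝ) (ω : Omega) : ℝ :=
  ∑ r ∈ Finset.range (n + 1),
    (-1 : ℝ) ^ (n - r) / 2 ^ (n - r) * (n.choose r : ℝ) *
      ∑' k : Fin r ↪ ℕ, ∫ y, f (jumpPoint n r k y ω) ∂(lebPi (n - r))

/-- `X` is (a version of) the multiple stochastic integral `I_n(f)`, the `L²`-extension of the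
explicit formula: `X` is the limit in `L²(Ω)` of the integrals of some integrable functions `g m` of
the same space that converge to `f` in `L²(ℝ₊ⁿ)`. -/
def IsMultInt (n : ℕ) (f : (Fin n → ℝ) → ℝ) (X : Omega → ℝ) : Prop :=
  MemLp X 2 prob ∧
  ∃ g : ℕ → (Fin n → ℝ) → ℝ,
    (∀ m, HatL2 n (g m) ∧ Integrable (g m) (lebPi n)) ∧
    Tendsto (fun m => eLpNorm (fun x => g m x - f x) 2 (lebPi n)) atTop (𝓝 0) ∧
    Tendsto (fun m => eLpNorm (fun ω => multIntL1 n (g m) ω - X ω) 2 prob) atTop (𝓝 0)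

/-- The left end point `2⌊t/2⌋` of the block `[2⌊t/2⌋, 2⌊t/2⌋ + 2]` of `t ≥ 0`. -/
def blockStart (t : ℝ) : ℝ := 2 * (⌊t / 2⌋₊ : ℝ)

/-- The map `Ψ_t`, which replaces `U_{⌊t/2⌋}` by `t - 2⌊t/2⌋ - 1`. -/
def Psi (t : ℝ) (ω : Omega) : Omega :=
  Function.update ω ⌊t / 2⌋₊ (t - blockStart t - 1)

/-- The finite difference operator
`∇_t X = X ∘ Ψ_t - (1/2) ∫_{2⌊t/2⌋}^{2⌊t/2⌋+2} X ∘ Ψ_s ds`. -/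
def nabla (X : Omega → ℝ) (t : ℝ) (ω : Omega) : ℝ :=
  X (Psi t ω) - 1 / 2 * ∫ s in (blockStart t)..(blockStart t + 2), X (Psi s ω)

/-- The Wasserstein distance between two laws on `ℝ` (with finite first moments): the supremum
of `|∫ h dμ - ∫ h dν|` over the functions `h` with Lipschitz constant at most `1`. -/
def wassersteinDist (μ ν : Measure ℝ) : ℝ≥0∞ :=
  ⨆ (h : ℝ → ℝ) (_ : LipschitzWith 1 h), ENNReal.ofReal |(∫ x, h x ∂μ) - ∫ x, h x ∂ν|

end UniformSeq

end

/-!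
A normal variable is characterised by Stein's equation: for a Lipschitz function `h` there is a
function `g` with `|g'| ≤ 1`, `g'` Lipschitz with constant `2`, and
`E[h(X)] - E[h(N)] = E[g'(X) - X g(X)]`. On the product space the conditional expectations `E_j`
given all coordinates but the `j`-th are commuting orthogonal projections of `L²(Ω)`, and the `n`-th
chaos, in which `I_n(f)` lies, consists of eigenvectors of `∑_j (1 - E_j)` for the eigenvalue `n`.
Hence `n E[X g(X)] = ∑_j E[(X - E_j X) g(X)]`. Expanding `g` to second order in each coordinate
turns the `j`-th summand into `E[g'(X) Var_j X]` up to a cubic remainder, and since `∇ X` on the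
block `[2j, 2j + 2]` is the dependence of `X - E_j X` on its `j`-th coordinate, `∑_j Var_j X` is the
squared norm of `∇ X` and the remainders are the last two terms of the bound.
-/

noncomputable section

namespace UniformSeq

/-! ### Stein's equation for the standard normal law -/

section GaussianTail

/-- The standard normal density `φ`. -/
def gaussDensity (x : ℝ) : ℝ := gaussianPDFReal 0 1 x

/-- The upper tail `Q x = ∫_x^∞ φ` of the standard normal law; its lower tail at `x` is `Q (-x)`. -/
def gaussTail (x : ℝ) : ℝ := ∫ t in Ioi x, gaussDensity t

/-- The mean excess `∫_x^∞ (t - x) φ(t) dt` of the standard normal law over the level `x`, in closed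
form. -/
def gaussExcess (x : ℝ) : ℝ := gaussDensity x - x * gaussTail x

lemma gaussDensity_eq (x : ℝ) :
    gaussDensity x = (√(2 * Real.pi))⁻¹ * Real.exp (-(1 / 2) * x ^ 2) := by
  simp only [gaussDensity, gaussianPDFReal, NNReal.coe_one, mul_one, sub_zero]
  congr 2
  ring

lemma gaussDensity_pos (x : ℝ) : 0 < gaussDensity x :=
  gaussianPDFReal_pos 0 1 x one_ne_zero

lemma gaussDensity_neg (x : ℝ) : gaussDensity (-x) = gaussDensity x := by
  simp only [gaussDensity_eq, even_two.neg_pow]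

lemma gaussDensity_le (x : ℝ) : gaussDensity x ≤ 2 / 5 := by
  have hsqrt : (5 / 2 : ℝ) ≤ √(2 * Real.pi) :=
    Real.le_sqrt_of_sq_le (by linarith [Real.pi_gt_d2])
  calc gaussDensity x ≤ (√(2 * Real.pi))⁻¹ * 1 := by
        rw [gaussDensity_eq]
        gcongr
        exact Real.exp_le_one_iff.2 (by nlinarith [sq_nonneg x])
    _ ≤ (5 / 2)⁻¹ * 1 := by gcongr
    _ = 2 / 5 := by norm_num

lemma hasDerivAt_gaussDensity (x : ℝ) : HasDerivAt gaussDensity (-(x * gaussDensity x)) x := by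
  rw [show gaussDensity = _ from funext gaussDensity_eq]
  refine ((((hasDerivAt_pow 2 x).const_mul (-(1 / 2) : ℝ)).exp).const_mul
    (√(2 * Real.pi))⁻¹).congr_deriv ?_
  simp only [Nat.cast_ofNat, Nat.add_one_sub_one, pow_one]
  ring

lemma continuous_gaussDensity : Continuous gaussDensity :=
  continuous_iff_continuousAt.2 fun x => (hasDerivAt_gaussDensity x).continuousAt

lemma integrable_pow_mul_gaussDensity (k : ℕ) : Integrable fun t => t ^ k * gaussDensity t := by
  have h := (integrable_rpow_mul_exp_neg_mul_sq (b := 1 / 2) (by norm_num) (s := k)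
    (by linarith [k.cast_nonneg (α := ℝ)])).const_mul (√(2 * Real.pi))⁻¹
  refine h.congr (ae_of_all _ fun t => ?_)
  simp only [gaussDensity_eq, Real.rpow_natCast]
  ring

lemma integrable_gaussDensity : Integrable gaussDensity := integrable_gaussianPDFReal 0 1

lemma integrable_id_mul_gaussDensity : Integrable fun t => t * gaussDensity t := by
  simpa only [pow_one] using integrable_pow_mul_gaussDensity 1

lemma hasDerivAt_integral_Ioi {E : Type*} [NormedAddCommGroup E] [NormedSpace ℝ E]
    [CompleteSpace E] {F : ℝ → E} (hF : Integrable F) (hc : Continuous F) (x : ℝ) :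
    HasDerivAt (fun x => ∫ t in Ioi x, F t) (-F x) x := by
  have hsplit : (fun x => ∫ t in Ioi x, F t) = fun x => (∫ t in Ioi 0, F t) - ∫ t in 0..x, F t := by
    ext y
    rw [eq_sub_iff_add_eq', intervalIntegral.integral_interval_add_Ioi hF.integrableOn
      hF.integrableOn]
  rw [hsplit]
  exact (hc.integral_hasStrictDerivAt 0 x).hasDerivAt.const_sub _

lemma hasDerivAt_gaussTail (x : ℝ) : HasDerivAt gaussTail (-gaussDensity x) x :=
  hasDerivAt_integral_Ioi integrable_gaussDensity continuous_gaussDensity x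

lemma gaussTail_neg_eq_integral_Iic (x : ℝ) : gaussTail (-x) = ∫ t in Iic x, gaussDensity t := by
  simp only [gaussTail, ← integral_comp_neg_Iic, gaussDensity_neg]

lemma gaussTail_neg (x : ℝ) : gaussTail (-x) = 1 - gaussTail x := by
  have h := intervalIntegral.integral_Iic_add_Ioi (b := x) integrable_gaussDensity.integrableOn
    integrable_gaussDensity.integrableOn
  have hone : ∫ t, gaussDensity t = 1 := integral_gaussianPDFReal_eq_one 0 one_ne_zero
  rw [gaussTail_neg_eq_integral_Iic, gaussTail]
  linarith

/-- The recursion for truncated moments; the truncated `k - 1` at `k = 0` is harmless. -/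
lemma integral_Ioi_pow_succ_mul_gaussDensity (k : ℕ) (x : ℝ) :
    ∫ t in Ioi x, t ^ (k + 1) * gaussDensity t
      = x ^ k * gaussDensity x + k * ∫ t in Ioi x, t ^ (k - 1) * gaussDensity t := by
  have hderiv (t : ℝ) : HasDerivAt (fun t => t ^ k * gaussDensity t)
      (k * (t ^ (k - 1) * gaussDensity t) - t ^ (k + 1) * gaussDensity t) t :=
    ((hasDerivAt_pow k t).mul (hasDerivAt_gaussDensity t)).congr_deriv (by ring)
  have hlow := (integrable_pow_mul_gaussDensity (k - 1)).const_mul (k : ℝ)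
  have hhigh := integrable_pow_mul_gaussDensity (k + 1)
  have h := integral_Ioi_of_hasDerivAt_of_tendsto' (a := x) (fun t _ => hderiv t)
    (hlow.sub hhigh).integrableOn (tendsto_zero_of_hasDerivAt_of_integrableOn_Ioi (a := x)
      (fun t _ => hderiv t) (hlow.sub hhigh).integrableOn
      (integrable_pow_mul_gaussDensity k).integrableOn)
  rw [integral_sub hlow.integrableOn hhigh.integrableOn, integral_const_mul] at h
  linarith

lemma integral_Ioi_id_mul_gaussDensity (x : ℝ) :
    ∫ t in Ioi x, t * gaussDensity t = gaussDensity x := by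
  simpa using integral_Ioi_pow_succ_mul_gaussDensity 0 x

lemma integral_Ioi_sub_mul_gaussDensity (x : ℝ) :
    ∫ t in Ioi x, (t - x) * gaussDensity t = gaussExcess x := by
  simp_rw [sub_mul]
  rw [integral_sub integrable_id_mul_gaussDensity.integrableOn
    (integrable_gaussDensity.const_mul x).integrableOn, integral_const_mul,
    integral_Ioi_id_mul_gaussDensity, gaussExcess, gaussTail]

lemma integral_Ioi_sub_sq_mul_gaussDensity (s x : ℝ) :
    ∫ t in Ioi x, (t - s) ^ 2 * gaussDensity t
      = (1 + s ^ 2) * gaussTail x - (2 * s - x) * gaussDensity x := by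
  have hsq : ∫ t in Ioi x, t ^ 2 * gaussDensity t = x * gaussDensity x + gaussTail x := by
    simpa [gaussTail] using integral_Ioi_pow_succ_mul_gaussDensity 1 x
  have hexpand (t : ℝ) : (t - s) ^ 2 * gaussDensity t
      = t ^ 2 * gaussDensity t - 2 * s * (t * gaussDensity t) + s ^ 2 * gaussDensity t := by ring
  have hi2 := (integrable_pow_mul_gaussDensity 2).integrableOn (s := Ioi x)
  have hi1 := (integrable_id_mul_gaussDensity.const_mul (2 * s)).integrableOn (s := Ioi x)
  have hi0 := (integrable_gaussDensity.const_mul (s ^ 2)).integrableOn (s := Ioi x)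
  simp_rw [hexpand]
  rw [integral_add (by exact hi2.sub hi1) hi0, integral_sub hi2 hi1, hsq, integral_const_mul,
    integral_const_mul, integral_Ioi_id_mul_gaussDensity, ← gaussTail]
  ring

lemma gaussExcess_nonneg (x : ℝ) : 0 ≤ gaussExcess x := by
  rw [← integral_Ioi_sub_mul_gaussDensity]
  exact setIntegral_nonneg measurableSet_Ioi fun t ht =>
    mul_nonneg (sub_nonneg.2 (le_of_lt ht)) (gaussDensity_pos t).le

/-- `s = x` is Gordon's bound for the Mills ratio, and the optimal `s` gives Birnbaum's. -/
lemma two_mul_sub_mul_gaussDensity_le (s x : ℝ) :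
    (2 * s - x) * gaussDensity x ≤ (1 + s ^ 2) * gaussTail x := by
  rw [← sub_nonneg, ← integral_Ioi_sub_sq_mul_gaussDensity]
  exact integral_nonneg fun t => mul_nonneg (sq_nonneg _) (gaussDensity_pos t).le

/-- With `x = 1 / θ - θ`, Birnbaum's bound reads `θ φ(x) ≤ Q(x)`. -/
lemma gaussExcess_le_sq_mul_gaussDensity {θ x : ℝ} (hθ : 0 < θ) (hx : 0 ≤ x)
    (hθx : θ ^ 2 + x * θ = 1) : gaussExcess x ≤ θ ^ 2 * gaussDensity x := by
  have hbirnbaum : θ * gaussDensity x ≤ gaussTail x := by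
    have h := two_mul_sub_mul_gaussDensity_le (x + θ) x
    have hsq : θ ^ 2 * (1 + (x + θ) ^ 2) = 1 + θ ^ 2 := by
      linear_combination (θ ^ 2 + x * θ + 1) * hθx
    have hlin : θ ^ 2 * (2 * (x + θ) - x) = θ * (1 + θ ^ 2) := by linear_combination θ * hθx
    refine le_of_mul_le_mul_left ?_ (by positivity : 0 < 1 + θ ^ 2)
    calc (1 + θ ^ 2) * (θ * gaussDensity x) = θ ^ 2 * ((2 * (x + θ) - x) * gaussDensity x) := by
          linear_combination -gaussDensity x * hlin
      _ ≤ θ ^ 2 * ((1 + (x + θ) ^ 2) * gaussTail x) := by gcongr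
      _ = (1 + θ ^ 2) * gaussTail x := by linear_combination gaussTail x * hsq
  calc gaussExcess x ≤ gaussDensity x - x * (θ * gaussDensity x) := by
        unfold gaussExcess
        gcongr
    _ = θ ^ 2 * gaussDensity x := by linear_combination -gaussDensity x * hθx

lemma gaussExcess_neg (x : ℝ) : gaussExcess (-x) = x + gaussExcess x := by
  rw [gaussExcess, gaussExcess, gaussDensity_neg, gaussTail_neg]
  ring

lemma two_mul_gaussExcess_mul_gaussExcess_neg_le (x : ℝ) :
    2 * (gaussExcess x * gaussExcess (-x)) ≤ gaussDensity x := by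
  wlog hx : 0 ≤ x generalizing x
  · simpa [mul_comm (gaussExcess x), gaussDensity_neg] using this (-x) (by linarith)
  obtain ⟨θ, hθ, hθx⟩ : ∃ θ : ℝ, 0 < θ ∧ θ ^ 2 + x * θ = 1 := by
    have hlt : x < √(x ^ 2 + 4) := Real.lt_sqrt_of_sq_lt (by linarith)
    refine ⟨(√(x ^ 2 + 4) - x) / 2, by linarith, ?_⟩
    linear_combination Real.sq_sqrt (show 0 ≤ x ^ 2 + 4 by positivity) / 4
  have hφ := gaussDensity_pos x
  have hexcess := gaussExcess_le_sq_mul_gaussDensity hθ hx hθx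
  have hθ1 : θ ≤ 1 := by nlinarith [mul_nonneg hx hθ.le]
  have hpoly : θ * (1 - θ ^ 2) + 2 / 5 * θ ^ 4 ≤ 1 / 2 := by
    nlinarith [sq_nonneg (θ - 3 / 4), sq_nonneg (θ ^ 2 - 9 / 16),
      mul_nonneg hθ.le (sub_nonneg.2 hθ1), mul_nonneg hθ.le (sq_nonneg (θ - 3 / 4))]
  calc 2 * (gaussExcess x * gaussExcess (-x))
      ≤ 2 * ((θ ^ 2 * gaussDensity x) * (x + θ ^ 2 * (2 / 5))) := by
        have := gaussExcess_nonneg x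
        have : gaussExcess x ≤ θ ^ 2 * (2 / 5) :=
          hexcess.trans (mul_le_mul_of_nonneg_left (gaussDensity_le x) (sq_nonneg θ))
        rw [gaussExcess_neg]
        gcongr
    _ = gaussDensity x * (2 * (θ * (1 - θ ^ 2) + 2 / 5 * θ ^ 4)) := by
        linear_combination 2 * gaussDensity x * θ * hθx
    _ ≤ gaussDensity x := by nlinarith

end GaussianTail

section SteinSolution

/-- The integral `∫_x^∞ (h(t) - h(x)) φ(t) dt`, from which the solution of Stein's equation for the
test function `h` is built. -/
def steinTail (h : ℝ → ℝ) (x : ℝ) : ℝ := ∫ t in Ioi x, (h t - h x) * gaussDensity t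

/-- The bounded solution of Stein's equation `g'(x) - x g(x) = h(x) - E[h(N)]`. The integral over
the lower half-line is written as an upper one for the reflected test function. -/
def steinSol (h : ℝ → ℝ) (x : ℝ) : ℝ :=
  (gaussTail x * steinTail (fun t => h (-t)) (-x) - gaussTail (-x) * steinTail h x) / gaussDensity x

/-- The derivative of `steinSol h`, as given by Stein's equation. -/
def steinDeriv (h : ℝ → ℝ) (x : ℝ) : ℝ :=
  x * steinSol h x + (h x - ∫ y, h y ∂(gaussianReal 0 1))

variable {h : ℝ → ℝ} {K : ℝ≥0}

lemma lipschitzWith_comp_neg (hL : LipschitzWith K h) : LipschitzWith K fun t => h (-t) :=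
  LipschitzWith.of_dist_le_mul fun s t => by simpa using hL.dist_le_mul (-s) (-t)

lemma abs_sub_le_of_lipschitzWith (hL : LipschitzWith K h) (x y : ℝ) :
    |h x - h y| ≤ K * |x - y| := by
  simpa only [Real.dist_eq] using hL.dist_le_mul x y

lemma integrable_mul_gaussDensity (hL : LipschitzWith K h) :
    Integrable fun t => h t * gaussDensity t := by
  refine Integrable.mono' (g := fun t => |h 0| * gaussDensity t + K * |t * gaussDensity t|)
    ((integrable_gaussDensity.const_mul _).add (integrable_id_mul_gaussDensity.abs.const_mul _))
    (hL.continuous.mul continuous_gaussDensity).aestronglyMeasurable (ae_of_all _ fun t => ?_)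
  have hgrowth : |h t| ≤ |h 0| + K * |t| := by
    have := abs_sub_le_of_lipschitzWith hL t 0
    rw [sub_zero] at this
    linarith [abs_sub_abs_le_abs_sub (h t) (h 0)]
  rw [Real.norm_eq_abs, abs_mul, abs_mul, abs_of_pos (gaussDensity_pos t), ← mul_assoc, ← add_mul]
  exact mul_le_mul_of_nonneg_right hgrowth (gaussDensity_pos t).le

lemma steinTail_eq (hL : LipschitzWith K h) (x : ℝ) :
    steinTail h x = (∫ t in Ioi x, h t * gaussDensity t) - h x * gaussTail x := by
  simp_rw [steinTail, sub_mul]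
  rw [integral_sub (integrable_mul_gaussDensity hL).integrableOn
    (integrable_gaussDensity.const_mul _).integrableOn, integral_const_mul, ← gaussTail]

lemma abs_steinTail_le (hL : LipschitzWith K h) (x : ℝ) :
    |steinTail h x| ≤ K * gaussExcess x := by
  rw [← integral_Ioi_sub_mul_gaussDensity, ← integral_const_mul]
  refine norm_integral_le_of_norm_le (f := fun t => (h t - h x) * gaussDensity t) ?_ ?_
  · simp_rw [sub_mul]
    exact ((integrable_id_mul_gaussDensity.sub
      (integrable_gaussDensity.const_mul x)).const_mul _).integrableOn
  · filter_upwards [ae_restrict_mem measurableSet_Ioi] with t ht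
    rw [norm_mul, Real.norm_eq_abs, Real.norm_eq_abs, abs_of_pos (gaussDensity_pos t), ← mul_assoc,
      ← abs_of_nonneg (sub_nonneg.2 (mem_Ioi.1 ht).le)]
    exact mul_le_mul_of_nonneg_right (abs_sub_le_of_lipschitzWith hL t x) (gaussDensity_pos t).le

lemma hasDerivAt_steinTail (hL : LipschitzWith K h) {h' x : ℝ} (hd : HasDerivAt h h' x) :
    HasDerivAt (steinTail h) (-(h' * gaussTail x)) x := by
  rw [show steinTail h = _ from funext (steinTail_eq hL)]
  refine ((hasDerivAt_integral_Ioi (integrable_mul_gaussDensity hL)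
    (hL.continuous.mul continuous_gaussDensity) x).sub
    (hd.mul (hasDerivAt_gaussTail x))).congr_deriv ?_
  ring

lemma integral_gaussianReal_eq (h : ℝ → ℝ) :
    ∫ y, h y ∂(gaussianReal 0 1) = ∫ y, h y * gaussDensity y := by
  simp only [integral_gaussianReal_eq_integral_smul one_ne_zero, smul_eq_mul, gaussDensity,
    mul_comm]

lemma neg_steinTail_sub_steinTail (hL : LipschitzWith K h) (x : ℝ) :
    -steinTail (fun t => h (-t)) (-x) - steinTail h x = h x - ∫ y, h y ∂(gaussianReal 0 1) := by
  have hint := integrable_mul_gaussDensity hL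
  have hreflect :
      ∫ t in Ioi (-x), h (-t) * gaussDensity t = ∫ t in Iic x, h t * gaussDensity t := by
    rw [← integral_comp_neg_Iic]
    simp only [neg_neg, gaussDensity_neg]
  rw [steinTail_eq hL, steinTail_eq (lipschitzWith_comp_neg hL), integral_gaussianReal_eq, hreflect,
    ← intervalIntegral.integral_Iic_add_Ioi (b := x) hint.integrableOn hint.integrableOn, neg_neg,
    gaussTail_neg]
  ring

lemma hasDerivAt_comp_neg {f : ℝ → ℝ} {f' x : ℝ} (hf : HasDerivAt f f' (-x)) :
    HasDerivAt (fun t => f (-t)) (-f') x :=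
  (hf.comp x (hasDerivAt_neg x)).congr_deriv (mul_neg_one f')

lemma hasDerivAt_steinSol (hL : LipschitzWith K h) (hd : Differentiable ℝ h) (x : ℝ) :
    HasDerivAt (steinSol h) (steinDeriv h x) x := by
  have hφ := (gaussDensity_pos x).ne'
  have hlower : HasDerivAt (fun x => steinTail (fun t => h (-t)) (-x))
      (-(deriv h x * gaussTail (-x))) x := by
    have hneg : HasDerivAt (fun t => h (-t)) (-deriv h x) (-x) := by
      simpa using hasDerivAt_comp_neg (hd (- -x)).hasDerivAt
    simpa using hasDerivAt_comp_neg (hasDerivAt_steinTail (lipschitzWith_comp_neg hL) hneg)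
  have htail : HasDerivAt (fun x => gaussTail (-x)) (gaussDensity x) x := by
    simpa [gaussDensity_neg] using hasDerivAt_comp_neg (hasDerivAt_gaussTail (-x))
  refine ((((hasDerivAt_gaussTail x).mul hlower).sub (htail.mul
    (hasDerivAt_steinTail hL (hd x).hasDerivAt))).div (hasDerivAt_gaussDensity x) hφ).congr_deriv ?_
  rw [steinDeriv, ← neg_steinTail_sub_steinTail hL, steinSol]
  simp only [Pi.mul_apply, Pi.sub_apply]
  field_simp
  ring

lemma gaussDensity_mul_steinDeriv (hL : LipschitzWith K h) (x : ℝ) :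
    gaussDensity x * steinDeriv h x = -(gaussExcess x * steinTail (fun t => h (-t)) (-x)
      + gaussExcess (-x) * steinTail h x) := by
  have hφ := (gaussDensity_pos x).ne'
  rw [steinDeriv, ← neg_steinTail_sub_steinTail hL, steinSol, gaussExcess, gaussExcess,
    gaussDensity_neg]
  field_simp
  ring

lemma abs_steinDeriv_le (hL : LipschitzWith K h) (x : ℝ) : |steinDeriv h x| ≤ K := by
  refine le_of_mul_le_mul_left ?_ (gaussDensity_pos x)
  have hx := gaussExcess_nonneg x
  have hnx := gaussExcess_nonneg (-x)
  calc gaussDensity x * |steinDeriv h x|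
      = |gaussExcess x * steinTail (fun t => h (-t)) (-x) + gaussExcess (-x) * steinTail h x| := by
        rw [← abs_neg (_ + _), ← gaussDensity_mul_steinDeriv hL, abs_mul,
          abs_of_pos (gaussDensity_pos x)]
    _ ≤ gaussExcess x * (K * gaussExcess (-x)) + gaussExcess (-x) * (K * gaussExcess x) := by
        refine (abs_add_le _ _).trans ?_
        rw [abs_mul, abs_mul, abs_of_nonneg hx, abs_of_nonneg hnx]
        gcongr
        · exact abs_steinTail_le (lipschitzWith_comp_neg hL) (-x)
        · exact abs_steinTail_le hL x
    _ = K * (2 * (gaussExcess x * gaussExcess (-x))) := by ring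
    _ ≤ K * gaussDensity x := by
        gcongr
        exact two_mul_gaussExcess_mul_gaussExcess_neg_le x
    _ = gaussDensity x * K := mul_comm _ _

lemma hasDerivAt_steinDeriv (hL : LipschitzWith K h) (hd : Differentiable ℝ h) (x : ℝ) :
    HasDerivAt (steinDeriv h) (steinSol h x + x * steinDeriv h x + deriv h x) x := by
  refine (((hasDerivAt_id x).mul (hasDerivAt_steinSol hL hd x)).add
    ((hd x).hasDerivAt.sub_const _)).congr_deriv ?_
  simp only [id_eq, one_mul]

lemma abs_steinSol_add_mul_steinDeriv_le (hL : LipschitzWith K h) (x : ℝ) :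
    |steinSol h x + x * steinDeriv h x| ≤ K := by
  let m (y : ℝ) : ℝ := (1 + y ^ 2) * gaussTail y - y * gaussDensity y
  have hm (y : ℝ) : 0 ≤ m y := by
    have := two_mul_sub_mul_gaussDensity_le y y
    simp only [m]
    linarith
  have hφ := gaussDensity_pos x
  have hsolve : gaussDensity x * (steinSol h x + x * steinDeriv h x)
      = m x * steinTail (fun t => h (-t)) (-x) - m (-x) * steinTail h x := by
    have hsol : gaussDensity x * steinSol h x
        = gaussTail x * steinTail (fun t => h (-t)) (-x) - gaussTail (-x) * steinTail h x :=
      mul_div_cancel₀ _ hφ.ne'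
    simp only [m, gaussDensity_neg]
    rw [mul_add, hsol, mul_left_comm, gaussDensity_mul_steinDeriv hL, gaussExcess, gaussExcess,
      gaussDensity_neg]
    ring
  have hwronskian : m x * gaussExcess (-x) + m (-x) * gaussExcess x = gaussDensity x := by
    simp only [m, gaussExcess, gaussDensity_neg, gaussTail_neg]
    ring
  refine le_of_mul_le_mul_left ?_ hφ
  calc gaussDensity x * |steinSol h x + x * steinDeriv h x|
      = |m x * steinTail (fun t => h (-t)) (-x) - m (-x) * steinTail h x| := by
        rw [← hsolve, abs_mul, abs_of_pos hφ]
    _ ≤ m x * (K * gaussExcess (-x)) + m (-x) * (K * gaussExcess x) := by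
        refine (abs_sub _ _).trans ?_
        rw [abs_mul, abs_mul, abs_of_nonneg (hm x), abs_of_nonneg (hm (-x))]
        gcongr
        · exact hm x
        · exact abs_steinTail_le (lipschitzWith_comp_neg hL) (-x)
        · exact hm (-x)
        · exact abs_steinTail_le hL x
    _ = gaussDensity x * K := by linear_combination (K : ℝ) * hwronskian

lemma lipschitzWith_steinDeriv (hL : LipschitzWith K h) (hd : Differentiable ℝ h) :
    LipschitzWith (2 * K) (steinDeriv h) := by
  refine lipschitzWith_of_nnnorm_deriv_le
    (fun x => (hasDerivAt_steinDeriv hL hd x).differentiableAt) fun x => ?_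
  rw [(hasDerivAt_steinDeriv hL hd x).deriv, ← NNReal.coe_le_coe, coe_nnnorm, two_mul]
  exact (norm_add_le _ _).trans (add_le_add (abs_steinSol_add_mul_steinDeriv_le hL x)
    (norm_deriv_le_of_lipschitz hL))

end SteinSolution

section RealFunctions

lemma norm_sub_sub_smul_le_of_lipschitzWith_deriv {E : Type*} [NormedAddCommGroup E]
    [NormedSpace ℝ E] {g g' : ℝ → E} {K : ℝ≥0} (hg : ∀ x, HasDerivAt g (g' x) x)
    (hg' : LipschitzWith K g') (x y : ℝ) :
    ‖g y - g x - (y - x) • g' x‖ ≤ K / 2 * (y - x) ^ 2 := by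
  let path (t : ℝ) : ℝ := x + t * (y - x)
  have hpath (t : ℝ) : HasDerivAt path (y - x) t :=
    (((hasDerivAt_id t).mul_const (y - x)).const_add x).congr_deriv (one_mul _)
  have hrem (t : ℝ) : HasDerivAt (fun t => g (path t) - g x - (t * (y - x)) • g' x)
      ((y - x) • (g' (path t) - g' x)) t := by
    refine ((((hg (path t)).scomp t (hpath t)).sub_const (g x)).sub
      (((hasDerivAt_id t).mul_const (y - x)).smul_const (g' x))).congr_deriv ?_
    rw [one_mul, smul_sub]
  have hbound (t : ℝ) : HasDerivAt (fun t => K / 2 * (y - x) ^ 2 * t ^ 2)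
      (K * (y - x) ^ 2 * t) t :=
    ((hasDerivAt_pow 2 t).const_mul _).congr_deriv (by ring)
  have := image_norm_le_of_norm_deriv_right_le_deriv_boundary (a := 0) (b := 1)
    (fun t _ => (hrem t).continuousAt.continuousWithinAt) (fun t _ => (hrem t).hasDerivWithinAt)
    (by simp [path]) hbound (fun t ht => ?_) (right_mem_Icc.2 zero_le_one)
  · simpa [path] using this
  · have hstep : dist (path t) x = t * |y - x| := by
      simp [path, abs_of_nonneg ht.1]
    calc ‖(y - x) • (g' (path t) - g' x)‖ ≤ |y - x| * (K * (t * |y - x|)) := by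
          rw [norm_smul, Real.norm_eq_abs, ← dist_eq_norm, ← hstep]
          gcongr
          exact hg'.dist_le_mul _ _
      _ = K * (y - x) ^ 2 * t := by rw [← sq_abs (y - x)]; ring

lemma integral_comp_add_eq_sub {h : ℝ → ℝ} (hc : Continuous h) (ε x : ℝ) :
    ∫ s in 0..ε, h (x + s) = (∫ t in 0..(x + ε), h t) - ∫ t in 0..x, h t := by
  rw [intervalIntegral.integral_comp_add_left, add_zero,
    intervalIntegral.integral_interval_sub_left (hc.intervalIntegrable _ _)
      (hc.intervalIntegrable _ _)]

/-- The approximation is the moving average over windows of length `ε`. -/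
lemma exists_differentiable_lipschitzWith_approx {h : ℝ → ℝ} {K : ℝ≥0} (hL : LipschitzWith K h)
    {ε : ℝ} (hε : 0 < ε) :
    ∃ k : ℝ → ℝ, Differentiable ℝ k ∧ LipschitzWith K k ∧ ∀ x, |h x - k x| ≤ K * ε := by
  have hcont (x : ℝ) : Continuous fun s => h (x + s) := hL.continuous.comp (continuous_const_add x)
  have hmean {F : ℝ → ℝ} {C : ℝ} (hF : ∀ s ∈ uIoc 0 ε, ‖F s‖ ≤ C) :
      |ε⁻¹ * ∫ s in 0..ε, F s| ≤ C := by
    have := intervalIntegral.norm_integral_le_of_norm_le_const hF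
    rw [sub_zero, abs_of_pos hε, Real.norm_eq_abs] at this
    rwa [abs_mul, abs_of_pos (inv_pos.2 hε), inv_mul_le_iff₀ hε, mul_comm ε]
  refine ⟨fun x => ε⁻¹ * ∫ s in 0..ε, h (x + s), ?_, LipschitzWith.of_dist_le_mul fun x y => ?_,
    fun x => ?_⟩
  · have hprim : Differentiable ℝ fun x => ∫ t in 0..x, h t := fun x =>
      (hL.continuous.integral_hasStrictDerivAt 0 x).hasDerivAt.differentiableAt
    simp_rw [integral_comp_add_eq_sub hL.continuous]
    exact ((hprim.comp (differentiable_id.add_const ε)).sub hprim).const_mul _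
  · rw [Real.dist_eq, Real.dist_eq, ← mul_sub, ← intervalIntegral.integral_sub
      ((hcont x).intervalIntegrable _ _) ((hcont y).intervalIntegrable _ _)]
    exact hmean fun s _ => by simpa using abs_sub_le_of_lipschitzWith hL (x + s) (y + s)
  · have hdiff : h x - ε⁻¹ * ∫ s in 0..ε, h (x + s) = ε⁻¹ * ∫ s in 0..ε, (h x - h (x + s)) := by
      rw [intervalIntegral.integral_sub (by simp) ((hcont x).intervalIntegrable _ _),
        intervalIntegral.integral_const, sub_zero, smul_eq_mul]
      field_simp
    rw [hdiff]
    refine hmean fun s hs => (abs_sub_le_of_lipschitzWith hL _ _).trans ?_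
    rw [uIoc_of_le hε.le] at hs
    rw [sub_add_cancel_left, abs_neg, abs_of_pos hs.1]
    exact mul_le_mul_of_nonneg_left hs.2 K.2

end RealFunctions

/-! ### Homogeneous chaoses of a family of orthogonal projections -/

section Hilbert

open scoped InnerProductSpace

variable {H ι κ : Type*} [NormedAddCommGroup H] [InnerProductSpace ℝ H]

section Projection

variable {T : H →ₗ[ℝ] H} (hT : T.IsSymmetricProjection)
include hT

lemma apply_apply_of_isSymmetricProjection (x : H) : T (T x) = T x :=
  LinearMap.congr_fun hT.isIdempotentElem x

lemma inner_sub_apply_sub_apply (x y : H) : ⟪x - T x, y - T y⟫_ℝ = ⟪x - T x, y⟫_ℝ := by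
  have : ⟪x - T x, T y⟫_ℝ = 0 := by
    rw [← hT.isSymmetric, map_sub, apply_apply_of_isSymmetricProjection hT, sub_self,
      inner_zero_left]
  rw [inner_sub_right, this, sub_zero]

lemma norm_sub_apply_sq (x : H) : ‖x - T x‖ ^ 2 = ⟪x - T x, x⟫_ℝ := by
  rw [← real_inner_self_eq_norm_sq, inner_sub_apply_sub_apply hT]

lemma norm_sq_eq_norm_apply_sq_add (x : H) : ‖x‖ ^ 2 = ‖T x‖ ^ 2 + ‖x - T x‖ ^ 2 := by
  have : ‖T x‖ ^ 2 = ⟪T x, x⟫_ℝ := by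
    rw [← real_inner_self_eq_norm_sq, ← hT.isSymmetric, apply_apply_of_isSymmetricProjection hT]
  rw [norm_sub_apply_sq hT, inner_sub_left, this, real_inner_self_eq_norm_sq]
  ring

lemma norm_sub_apply_le (x : H) : ‖x - T x‖ ≤ ‖x‖ :=
  (sq_le_sq₀ (norm_nonneg _) (norm_nonneg _)).1
    (by linarith [norm_sq_eq_norm_apply_sq_add hT x, sq_nonneg ‖T x‖])

lemma norm_apply_le (x : H) : ‖T x‖ ≤ ‖x‖ :=
  (sq_le_sq₀ (norm_nonneg _) (norm_nonneg _)).1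
    (by linarith [norm_sq_eq_norm_apply_sq_add hT x, sq_nonneg ‖x - T x‖])

lemma norm_sub_apply_le_of_fixed (x : H) {y : H} (hy : T y = y) : ‖x - T x‖ ≤ ‖x - y‖ := by
  simpa only [map_sub, hy, sub_sub_sub_cancel_right] using norm_sub_apply_le hT (x - y)

lemma continuous_of_isSymmetricProjection : Continuous T :=
  (T.mkContinuous 1 fun x => by simpa using norm_apply_le hT x).continuous

end Projection

/-- The component of index `s` of the Hoeffding decomposition with respect to a family `E` of
projections, thought of as averages over the coordinates: the vectors annihilated by `E j` for
`j ∈ s` and fixed by `E j` for `j ∉ s`. -/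
def hoeffdingComponent (E : ι → H →ₗ[ℝ] H) (s : Finset ι) : Submodule ℝ H :=
  (⨅ j ∈ s, LinearMap.ker (E j)) ⊓ ⨅ j ∉ s, LinearMap.eqLocus (E j) LinearMap.id

/-- The homogeneous chaos of order `n`: the closed span of the components of the Hoeffding
decomposition that are indexed by sets with `n` elements. -/
def chaos (E : ι → H →ₗ[ℝ] H) (n : ℕ) : Submodule ℝ H :=
  (⨆ s : {s : Finset ι // s.card = n}, hoeffdingComponent E s).topologicalClosure

variable {E : ι → H →ₗ[ℝ] H}

lemma mem_hoeffdingComponent {s : Finset ι} {x : H} :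
    x ∈ hoeffdingComponent E s ↔ (∀ j ∈ s, E j x = 0) ∧ ∀ j ∉ s, E j x = x := by
  simp [hoeffdingComponent]

/-- The vectors of the homogeneous chaos of order `n` are eigenvectors, with eigenvalue `n`, of the
number operator `∑ j, (1 - E j)`. -/
lemma eventually_sum_sub_eq {n : ℕ} {x : H}
    (hx : x ∈ ⨆ s : {s : Finset ι // s.card = n}, hoeffdingComponent E s) :
    ∀ᶠ J : Finset ι in atTop, ∑ j ∈ J, (x - E j x) = (n : ℝ) • x := by
  classical
  induction hx using Submodule.iSup_induction' with
  | mem s x hx =>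
    obtain ⟨hmem, hnotMem⟩ := mem_hoeffdingComponent.1 hx
    have h : ∀ j, x - E j x = if j ∈ s.1 then x else 0 := fun j => by
      split_ifs with hj
      · rw [hmem j hj, sub_zero]
      · rw [hnotMem j hj, sub_self]
    filter_upwards [eventually_ge_atTop s.1] with J hJ
    simp only [h, Finset.sum_ite_mem, Finset.inter_eq_right.2 hJ, Finset.sum_const, s.2,
      Nat.cast_smul_eq_nsmul]
  | zero => simp
  | add x y _ _ hx hy =>
    filter_upwards [hx, hy] with J hJx hJy
    simp only [map_add, add_sub_add_comm, Finset.sum_add_distrib, hJx, hJy, smul_add]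

section Chaos

variable (hE : ∀ j, (E j).IsSymmetricProjection)
include hE

lemma sum_norm_sub_apply_sq_le {n : ℕ} {x : H} (hx : x ∈ chaos E n) (J : Finset ι) :
    ∑ j ∈ J, ‖x - E j x‖ ^ 2 ≤ n * ‖x‖ ^ 2 := by
  have hcont := fun j => continuous_of_isSymmetricProjection (hE j)
  refine closure_minimal (fun z hz => ?_) (isClosed_le (f := fun x => ∑ j ∈ J, ‖x - E j x‖ ^ 2)
    (g := fun x => n * ‖x‖ ^ 2) (by fun_prop) (by fun_prop)) hx
  obtain ⟨K, hK, hJK⟩ := ((eventually_sum_sub_eq hz).and (eventually_ge_atTop J)).exists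
  calc ∑ j ∈ J, ‖z - E j z‖ ^ 2 ≤ ∑ j ∈ K, ‖z - E j z‖ ^ 2 :=
        Finset.sum_le_sum_of_subset_of_nonneg hJK fun _ _ _ => by positivity
    _ = ⟪∑ j ∈ K, (z - E j z), z⟫_ℝ := by simp only [norm_sub_apply_sq (hE _), sum_inner]
    _ = n * ‖z‖ ^ 2 := by rw [hK, real_inner_smul_left, real_inner_self_eq_norm_sq]

lemma summable_norm_sub_apply_sq {n : ℕ} {x : H} (hx : x ∈ chaos E n) :
    Summable fun j => ‖x - E j x‖ ^ 2 :=
  summable_of_sum_le (fun _ => by positivity) (sum_norm_sub_apply_sq_le hE hx)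

lemma abs_sum_inner_sub_apply_le {n : ℕ} {x y : H} (hx : x ∈ chaos E n)
    (hy : Summable fun j => ‖y - E j y‖ ^ 2) (J : Finset ι) :
    |∑ j ∈ J, ⟪x - E j x, y⟫_ℝ| ≤ √n * √(∑' j, ‖y - E j y‖ ^ 2) * ‖x‖ := by
  calc |∑ j ∈ J, ⟪x - E j x, y⟫_ℝ| = |∑ j ∈ J, ⟪x - E j x, y - E j y⟫_ℝ| := by
        simp only [inner_sub_apply_sub_apply (hE _)]
    _ ≤ ∑ j ∈ J, ‖x - E j x‖ * ‖y - E j y‖ := (Finset.abs_sum_le_sum_abs _ _).trans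
        (Finset.sum_le_sum fun j _ => abs_real_inner_le_norm _ _)
    _ ≤ √(∑ j ∈ J, ‖x - E j x‖ ^ 2) * √(∑ j ∈ J, ‖y - E j y‖ ^ 2) :=
        Real.sum_mul_le_sqrt_mul_sqrt _ _ _
    _ ≤ √(n * ‖x‖ ^ 2) * √(∑' j, ‖y - E j y‖ ^ 2) := by
        gcongr
        · exact sum_norm_sub_apply_sq_le hE hx J
        · exact hy.sum_le_tsum _ fun _ _ => by positivity
    _ = _ := by rw [Real.sqrt_mul (by positivity), Real.sqrt_sq (norm_nonneg _)]; ring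

lemma hasSum_inner_sub_apply {n : ℕ} {x y : H} (hx : x ∈ chaos E n)
    (hy : Summable fun j => ‖y - E j y‖ ^ 2) :
    HasSum (fun j => ⟪x - E j x, y⟫_ℝ) (n * ⟪x, y⟫_ℝ) := by
  set C := √n * √(∑' j, ‖y - E j y‖ ^ 2) + n * ‖y‖
  rw [HasSum, SummationFilter.unconditional_filter, Metric.tendsto_nhds]
  intro ε hε
  obtain ⟨z, hz, hxz⟩ := Metric.mem_closure_iff.1 hx (ε / (C + 1)) (by positivity)
  have hw : x - z ∈ chaos E n := Submodule.sub_mem _ hx (Submodule.le_topologicalClosure _ hz)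
  have hwC : C * ‖x - z‖ < ε := by
    rw [dist_eq_norm, lt_div_iff₀ (by positivity)] at hxz
    nlinarith [norm_nonneg (x - z)]
  filter_upwards [eventually_sum_sub_eq hz] with J hJ
  have hzJ : ∑ j ∈ J, ⟪z - E j z, y⟫_ℝ = n * ⟪z, y⟫_ℝ := by
    rw [← sum_inner, hJ, real_inner_smul_left]
  have hsplit : ∑ j ∈ J, ⟪x - E j x, y⟫_ℝ - n * ⟪x, y⟫_ℝ
      = ∑ j ∈ J, ⟪x - z - E j (x - z), y⟫_ℝ - n * ⟪x - z, y⟫_ℝ := by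
    simp only [map_sub, sub_sub_sub_comm x z, inner_sub_left (_ - _), inner_sub_left x z,
      Finset.sum_sub_distrib, hzJ]
    ring
  have hinner : |n * ⟪x - z, y⟫_ℝ| ≤ n * ‖y‖ * ‖x - z‖ := by
    rw [abs_mul, Nat.abs_cast, mul_assoc, mul_comm ‖y‖]
    gcongr
    exact abs_real_inner_le_norm _ _
  rw [Real.dist_eq, hsplit]
  calc _ ≤ _ := abs_sub _ _
    _ ≤ C * ‖x - z‖ := by
      rw [add_mul]
      exact add_le_add (abs_sum_inner_sub_apply_le hE hw hy J) hinner
    _ < ε := hwC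

lemma orthogonalFamily_hoeffdingComponent :
    OrthogonalFamily ℝ (fun s => hoeffdingComponent E s)
      fun s => (hoeffdingComponent E s).subtypeₗᵢ := by
  classical
  have horth : ∀ {s t : Finset ι} {x y : H} {j : ι}, x ∈ hoeffdingComponent E s →
      y ∈ hoeffdingComponent E t → j ∈ s → j ∉ t → ⟪x, y⟫_ℝ = 0 := fun hx hy hjs hjt => by
    rw [← (mem_hoeffdingComponent.1 hy).2 _ hjt, ← (hE _).isSymmetric,
      (mem_hoeffdingComponent.1 hx).1 _ hjs, inner_zero_left]
  intro s t hst x y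
  obtain ⟨j, hj⟩ := Finset.symmDiff_nonempty.2 hst
  rcases Finset.mem_symmDiff.1 hj with ⟨hjs, hjt⟩ | ⟨hjt, hjs⟩
  · exact horth x.2 y.2 hjs hjt
  · exact (real_inner_comm _ _).trans (horth y.2 x.2 hjt hjs)

section Family

variable {M : ℕ} {G : κ → H} {s : κ → Finset ι} (hG : ∀ k, G k ∈ hoeffdingComponent E (s k))
  [DecidableEq ι] (hM : ∀ (t : Finset κ) u, {k ∈ t | s k = u}.card ≤ M)
include hG hM

lemma norm_sum_sq_le (t : Finset κ) : ‖∑ k ∈ t, G k‖ ^ 2 ≤ M * ∑ k ∈ t, ‖G k‖ ^ 2 := by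
  let F : ∀ u, hoeffdingComponent E u := fun u => ⟨∑ k ∈ t with s k = u, G k,
    Submodule.sum_mem _ fun k hk => (Finset.mem_filter.1 hk).2 ▸ hG k⟩
  have hfiber : ∀ k ∈ t, s k ∈ t.image s := fun _ => Finset.mem_image_of_mem s
  calc ‖∑ k ∈ t, G k‖ ^ 2 = ‖∑ u ∈ t.image s, (F u : H)‖ ^ 2 := by
        rw [← Finset.sum_fiberwise_of_maps_to hfiber]
    _ = ∑ u ∈ t.image s, ‖∑ k ∈ t with s k = u, G k‖ ^ 2 :=
        (orthogonalFamily_hoeffdingComponent hE).norm_sum F _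
    _ ≤ ∑ u ∈ t.image s, M * ∑ k ∈ t with s k = u, ‖G k‖ ^ 2 := by
        refine Finset.sum_le_sum fun u _ => ?_
        calc ‖∑ k ∈ t with s k = u, G k‖ ^ 2 ≤ (∑ k ∈ t with s k = u, ‖G k‖) ^ 2 := by
              gcongr
              exact norm_sum_le _ _
          _ ≤ ({k ∈ t | s k = u}.card : ℝ) * ∑ k ∈ t with s k = u, ‖G k‖ ^ 2 :=
              sq_sum_le_card_mul_sum_sq
          _ ≤ M * ∑ k ∈ t with s k = u, ‖G k‖ ^ 2 := by
              gcongr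
              exact hM t u
    _ = M * ∑ k ∈ t, ‖G k‖ ^ 2 := by
        rw [← Finset.mul_sum, Finset.sum_fiberwise_of_maps_to hfiber]

variable [CompleteSpace H] (hsum : Summable fun k => ‖G k‖ ^ 2)
include hsum

lemma summable_of_mem_hoeffdingComponent : Summable G := by
  rw [summable_iff_vanishing_norm]
  intro ε hε
  obtain ⟨t, ht⟩ := summable_iff_vanishing_norm.1 hsum (ε ^ 2 / (M + 1)) (by positivity)
  refine ⟨t, fun u hu => ?_⟩
  have hnonneg : (0 : ℝ) ≤ ∑ k ∈ u, ‖G k‖ ^ 2 := Finset.sum_nonneg fun _ _ => by positivity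
  have hlt := ht u hu
  rw [Real.norm_of_nonneg hnonneg, lt_div_iff₀ (by positivity)] at hlt
  exact lt_of_pow_lt_pow_left₀ 2 hε.le (by linarith [norm_sum_sq_le hE hG hM u])

lemma norm_tsum_sq_le : ‖∑' k, G k‖ ^ 2 ≤ M * ∑' k, ‖G k‖ ^ 2 :=
  le_of_tendsto_of_tendsto
    ((summable_of_mem_hoeffdingComponent hE hG hM hsum).hasSum.norm.pow 2)
    (hsum.hasSum.const_mul (M : ℝ)) (Eventually.of_forall fun t => norm_sum_sq_le hE hG hM t)

end Family

end Chaos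

lemma tsum_mem_chaos {n : ℕ} {G : κ → H} {s : κ → Finset ι}
    (hG : ∀ k, G k ∈ hoeffdingComponent E (s k)) (hs : ∀ k, (s k).card = n) :
    ∑' k, G k ∈ chaos E n := by
  have hmem : ∀ k, G k ∈ ⨆ s : {s : Finset ι // s.card = n}, hoeffdingComponent E s := fun k =>
    Submodule.mem_iSup_of_mem ⟨s k, hs k⟩ (hG k)
  by_cases h : Summable G
  · exact mem_closure_of_tendsto h.hasSum
      (Eventually.of_forall fun t => Submodule.sum_mem _ fun k _ => hmem k)
  · rw [tsum_eq_zero_of_not_summable h]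
    exact Submodule.zero_mem _

end Hilbert

/-! ### Averages over finitely many coordinates of a product probability space -/

section L2

variable {α β : Type*} [MeasurableSpace α] [MeasurableSpace β] {μ : Measure α} {ν : Measure β}

open scoped InnerProductSpace

lemma integral_comp_of_measurePreserving {φ : α → β} (hφ : MeasurePreserving φ μ ν) {F : β → ℝ}
    (hF : AEStronglyMeasurable F ν) : ∫ x, F (φ x) ∂μ = ∫ y, F y ∂ν := by
  rw [← hφ.map_eq] at hF ⊢
  exact (integral_map hφ.measurable.aemeasurable hF).symm

lemma sq_integral_le_integral_sq [IsProbabilityMeasure μ] {X : α → ℝ} (hX : MemLp X 2 μ) :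
    (∫ ω, X ω ∂μ) ^ 2 ≤ ∫ ω, X ω ^ 2 ∂μ := by
  have h := variance_nonneg X μ
  rw [variance_eq_sub hX] at h
  exact sub_nonneg.1 h

lemma inner_eq_integral_mul (f g : Lp ℝ 2 μ) : ⟪f, g⟫_ℝ = ∫ ω, f ω * g ω ∂μ := by
  rw [L2.inner_def]
  exact integral_congr_ae (ae_of_all _ fun ω => by simp [mul_comm])

lemma norm_sq_eq_integral_sq (f : Lp ℝ 2 μ) : ‖f‖ ^ 2 = ∫ ω, f ω ^ 2 ∂μ := by
  rw [← real_inner_self_eq_norm_sq, inner_eq_integral_mul]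
  simp only [sq]

lemma inner_toLp_toLp {X Y : α → ℝ} (hX : MemLp X 2 μ) (hY : MemLp Y 2 μ) :
    ⟪hX.toLp, hY.toLp⟫_ℝ = ∫ ω, X ω * Y ω ∂μ := by
  rw [inner_eq_integral_mul]
  refine integral_congr_ae ?_
  filter_upwards [hX.coeFn_toLp, hY.coeFn_toLp] with ω hXω hYω
  rw [hXω, hYω]

lemma norm_toLp_sq {X : α → ℝ} (hX : MemLp X 2 μ) : ‖hX.toLp‖ ^ 2 = ∫ ω, X ω ^ 2 ∂μ := by
  rw [← real_inner_self_eq_norm_sq, inner_toLp_toLp]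
  simp only [sq]

end L2

section Average

open MeasureTheory.Measure (infinitePi)

variable {ι : Type*} [DecidableEq ι] {Ω : ι → Type*}

lemma piecewise_union_eq (A B : Finset ι) (ω ω' ω'' : ∀ i, Ω i) :
    (A ∪ B).piecewise (A.piecewise ω' ω'') ω = A.piecewise ω' (B.piecewise ω'' ω) := by
  ext j
  by_cases h : j ∈ A <;> by_cases h' : j ∈ B <;> simp [h, h']

variable [∀ i, MeasurableSpace (Ω i)]

lemma measurable_piecewise_prod (A : Finset ι) :
    Measurable fun p : (∀ i, Ω i) × (∀ i, Ω i) => A.piecewise p.2 p.1 := by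
  refine measurable_pi_lambda _ fun j => ?_
  by_cases h : j ∈ A <;> simp only [h, Finset.piecewise_eq_of_mem, Finset.piecewise_eq_of_notMem,
    not_false_eq_true] <;> fun_prop

variable (μ : ∀ i, Measure (Ω i))

/-- The average of `X` over the coordinates in `A`. -/
def avg (A : Finset ι) (X : (∀ i, Ω i) → ℝ) (ω : ∀ i, Ω i) : ℝ :=
  ∫ ω', X (A.piecewise ω' ω) ∂infinitePi μ

variable [∀ i, IsProbabilityMeasure (μ i)]

lemma measurePreserving_piecewise (A : Finset ι) :
    MeasurePreserving (fun p : (∀ i, Ω i) × (∀ i, Ω i) => A.piecewise p.2 p.1)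
      ((infinitePi μ).prod (infinitePi μ)) (infinitePi μ) := by
  refine ⟨measurable_piecewise_prod A, Measure.eq_infinitePi _ fun s t ht => ?_⟩
  have hpre : (fun p : (∀ i, Ω i) × (∀ i, Ω i) => A.piecewise p.2 p.1) ⁻¹' (s : Set ι).pi t
      = ((↑(s \ A) : Set ι).pi t) ×ˢ ((↑(s ∩ A) : Set ι).pi t) := by
    ext p
    simp only [mem_preimage, Set.mem_pi, mem_prod, Finset.mem_coe, Finset.mem_sdiff,
      Finset.mem_inter]
    refine ⟨fun h => ⟨fun j hj => by simpa [hj.2] using h j hj.1,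
      fun j hj => by simpa [hj.2] using h j hj.1⟩, fun h j hj => ?_⟩
    by_cases hA : j ∈ A
    · simpa [hA] using h.2 j ⟨hj, hA⟩
    · simpa [hA] using h.1 j ⟨hj, hA⟩
  rw [Measure.map_apply (measurable_piecewise_prod A) (.pi s.countable_toSet fun _ _ => ht _), hpre,
    Measure.prod_prod, Measure.infinitePi_pi _ fun _ _ => ht _,
    Measure.infinitePi_pi _ fun _ _ => ht _, mul_comm, Finset.prod_inter_mul_prod_sdiff]

variable {μ} (A B : Finset ι) {X Y : (∀ i, Ω i) → ℝ}

lemma avg_congr (h : X =ᵐ[infinitePi μ] Y) : avg μ A X =ᵐ[infinitePi μ] avg μ A Y := by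
  filter_upwards [Measure.ae_ae_of_ae_prod
    ((measurePreserving_piecewise μ A).quasiMeasurePreserving.ae h)] with ω hω
  exact integral_congr_ae hω

lemma integrable_comp_piecewise (hX : Integrable X (infinitePi μ)) :
    Integrable (fun p : (∀ i, Ω i) × (∀ i, Ω i) => X (A.piecewise p.2 p.1))
      ((infinitePi μ).prod (infinitePi μ)) :=
  (measurePreserving_piecewise μ A).integrable_comp_of_integrable hX

lemma ae_integrable_piecewise (hX : Integrable X (infinitePi μ)) :
    ∀ᵐ ω ∂infinitePi μ, Integrable (fun ω' => X (A.piecewise ω' ω)) (infinitePi μ) :=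
  (integrable_comp_piecewise A hX).prod_right_ae

lemma ae_memLp_piecewise (hX : MemLp X 2 (infinitePi μ)) :
    ∀ᵐ ω ∂infinitePi μ, MemLp (fun ω' => X (A.piecewise ω' ω)) 2 (infinitePi μ) := by
  have h := hX.comp_measurePreserving (measurePreserving_piecewise μ A)
  filter_upwards [h.1.prodMk_left, h.integrable_sq.prod_right_ae] with ω hmeas hint
  exact (memLp_two_iff_integrable_sq hmeas).2 hint

lemma integrable_avg (hX : Integrable X (infinitePi μ)) : Integrable (avg μ A X) (infinitePi μ) :=
  (integrable_comp_piecewise A hX).integral_prod_left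

lemma integral_avg (hX : Integrable X (infinitePi μ)) :
    ∫ ω, avg μ A X ω ∂infinitePi μ = ∫ ω, X ω ∂infinitePi μ := by
  simp only [avg]
  rw [← integral_prod _ (integrable_comp_piecewise A hX)]
  exact integral_comp_of_measurePreserving (measurePreserving_piecewise μ A) hX.1

lemma memLp_avg (hX : MemLp X 2 (infinitePi μ)) : MemLp (avg μ A X) 2 (infinitePi μ) := by
  have hA := (integrable_avg A (hX.integrable (by norm_num))).1
  refine (memLp_two_iff_integrable_sq hA).2
    ((integrable_avg A hX.integrable_sq).mono' (hA.pow 2) ?_)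
  filter_upwards [ae_memLp_piecewise A hX] with ω hω
  rw [Real.norm_of_nonneg (sq_nonneg _)]
  exact sq_integral_le_integral_sq hω

lemma avg_avg (hX : Integrable X (infinitePi μ)) :
    avg μ B (avg μ A X) =ᵐ[infinitePi μ] avg μ (A ∪ B) X := by
  filter_upwards [ae_integrable_piecewise (A ∪ B) hX] with ω hω
  simp only [avg, ← piecewise_union_eq]
  rw [← integral_prod (fun p : (∀ i, Ω i) × (∀ i, Ω i) =>
    X ((A ∪ B).piecewise (A.piecewise p.2 p.1) ω)) (integrable_comp_piecewise A hω)]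
  exact integral_comp_of_measurePreserving (measurePreserving_piecewise μ A) hω.1

lemma integral_avg_mul_avg (hX : MemLp X 2 (infinitePi μ)) (hY : MemLp Y 2 (infinitePi μ)) :
    ∫ ω, avg μ A X ω * avg μ A Y ω ∂infinitePi μ = ∫ ω, X ω * avg μ A Y ω ∂infinitePi μ := by
  rw [← integral_avg A (X := fun ω => X ω * avg μ A Y ω) (hX.integrable_mul (memLp_avg A hY))]
  refine integral_congr_ae (ae_of_all _ fun ω => ?_)
  simp only [avg, Finset.piecewise_idem_right, integral_mul_const]

open scoped InnerProductSpace

variable (μ)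

/-- Averaging over the coordinates in `A`, as an operator on `L²`. -/
def avgL : Lp ℝ 2 (infinitePi μ) →ₗ[ℝ] Lp ℝ 2 (infinitePi μ) where
  toFun f := (memLp_avg A (Lp.memLp f)).toLp
  map_add' f g := by
    rw [← MemLp.toLp_add, MemLp.toLp_eq_toLp_iff]
    filter_upwards [avg_congr A (Lp.coeFn_add f g),
      ae_integrable_piecewise A ((Lp.memLp f).integrable (by norm_num)),
      ae_integrable_piecewise A ((Lp.memLp g).integrable (by norm_num))] with ω h hf hg
    rw [h]
    exact integral_add hf hg
  map_smul' c f := by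
    rw [RingHom.id_apply, ← MemLp.toLp_const_smul, MemLp.toLp_eq_toLp_iff]
    filter_upwards [avg_congr A (Lp.coeFn_smul c f)] with ω h
    rw [h]
    exact integral_const_mul c _

variable {μ}

lemma coeFn_avgL (f : Lp ℝ 2 (infinitePi μ)) : avgL μ A f =ᵐ[infinitePi μ] avg μ A f :=
  (memLp_avg A (Lp.memLp f)).coeFn_toLp

lemma avgL_toLp (hX : MemLp X 2 (infinitePi μ)) :
    avgL μ A hX.toLp = (memLp_avg A hX).toLp :=
  MemLp.toLp_congr (memLp_avg A (Lp.memLp _)) (memLp_avg A hX) (avg_congr A hX.coeFn_toLp)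

lemma avgL_avgL (f : Lp ℝ 2 (infinitePi μ)) : avgL μ B (avgL μ A f) = avgL μ (A ∪ B) f :=
  MemLp.toLp_congr (memLp_avg B (Lp.memLp _)) (memLp_avg (A ∪ B) (Lp.memLp f))
    ((avg_congr B (coeFn_avgL A f)).trans
      (avg_avg A B ((Lp.memLp f).integrable (by norm_num))))

lemma inner_avgL_avgL (f g : Lp ℝ 2 (infinitePi μ)) :
    ⟪avgL μ A f, avgL μ A g⟫_ℝ = ⟪f, avgL μ A g⟫_ℝ := by
  have hf := Lp.memLp f
  have hg := Lp.memLp g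
  calc ⟪avgL μ A f, avgL μ A g⟫_ℝ = ∫ ω, avg μ A f ω * avg μ A g ω ∂infinitePi μ :=
        inner_toLp_toLp (memLp_avg A hf) (memLp_avg A hg)
    _ = ∫ ω, f ω * avg μ A g ω ∂infinitePi μ := integral_avg_mul_avg A hf hg
    _ = ⟪hf.toLp, avgL μ A g⟫_ℝ := (inner_toLp_toLp hf (memLp_avg A hg)).symm
    _ = ⟪f, avgL μ A g⟫_ℝ := by rw [Lp.toLp_coeFn]

variable (μ) in
lemma isSymmetricProjection_avgL : (avgL μ A).IsSymmetricProjection where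
  isIdempotentElem := LinearMap.ext fun f => by
    rw [Module.End.mul_apply, avgL_avgL, Finset.union_self]
  isSymmetric f g := by
    rw [← inner_avgL_avgL A f g, real_inner_comm, ← inner_avgL_avgL A g f, real_inner_comm]

variable (μ) in
/-- The projection on the component of index `A` of the Hoeffding decomposition, by inclusion and
exclusion, for functions that depend only on the coordinates in `A`. -/
def hoeffdingProj : Lp ℝ 2 (infinitePi μ) →ₗ[ℝ] Lp ℝ 2 (infinitePi μ) :=
  ∑ C ∈ A.powerset, ((-1 : ℝ) ^ C.card) • avgL μ C

lemma hoeffdingProj_apply (f : Lp ℝ 2 (infinitePi μ)) :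
    hoeffdingProj μ A f = ∑ C ∈ A.powerset, ((-1 : ℝ) ^ C.card) • avgL μ C f := by
  simp only [hoeffdingProj, LinearMap.sum_apply, LinearMap.smul_apply]

lemma coeFn_hoeffdingProj_toLp {X : (∀ i, Ω i) → ℝ} (hX : MemLp X 2 (infinitePi μ)) :
    hoeffdingProj μ A hX.toLp =ᵐ[infinitePi μ]
      fun ω => ∑ C ∈ A.powerset, (-1 : ℝ) ^ C.card * avg μ C X ω := by
  have hterm : ∀ C : Finset ι, (((-1 : ℝ) ^ C.card) • avgL μ C hX.toLp : Lp ℝ 2 (infinitePi μ))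
      =ᵐ[infinitePi μ] fun ω => (-1 : ℝ) ^ C.card * avg μ C X ω := fun C => by
    rw [avgL_toLp C hX]
    filter_upwards [Lp.coeFn_smul ((-1 : ℝ) ^ C.card) (memLp_avg C hX).toLp,
      (memLp_avg C hX).coeFn_toLp] with ω hsmul hval
    rw [hsmul, Pi.smul_apply, hval, smul_eq_mul]
  rw [hoeffdingProj_apply]
  filter_upwards [Lp.coeFn_finsetSum A.powerset fun C => ((-1 : ℝ) ^ C.card) • avgL μ C hX.toLp,
    (ae_ball_iff A.powerset.countable_toSet).2 fun C _ => hterm C] with ω hsum hterm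
  rw [hsum, Finset.sum_apply]
  exact Finset.sum_congr rfl hterm

variable {A}

lemma avgL_singleton_hoeffdingProj_of_mem {j : ι} (hj : j ∈ A) (f : Lp ℝ 2 (infinitePi μ)) :
    avgL μ {j} (hoeffdingProj μ A f) = 0 := by
  rw [hoeffdingProj_apply, ← Finset.insert_erase hj,
    Finset.sum_powerset_insert (Finset.notMem_erase j A), ← Finset.sum_add_distrib, map_sum]
  refine Finset.sum_eq_zero fun C hC => ?_
  have hjC : j ∉ C := fun h => Finset.notMem_erase j A (Finset.mem_powerset.1 hC h)
  have hunion : insert j C ∪ {j} = C ∪ {j} := by ext; simp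
  rw [Finset.card_insert_of_notMem hjC, map_add, map_smul, map_smul, avgL_avgL, avgL_avgL,
    hunion, ← add_smul, pow_succ, mul_neg_one, add_neg_cancel, zero_smul]

lemma avgL_singleton_hoeffdingProj_of_fixed {j : ι} {f : Lp ℝ 2 (infinitePi μ)}
    (hf : avgL μ {j} f = f) : avgL μ {j} (hoeffdingProj μ A f) = hoeffdingProj μ A f := by
  rw [hoeffdingProj_apply, map_sum]
  refine Finset.sum_congr rfl fun C _ => ?_
  rw [map_smul, avgL_avgL, Finset.union_comm, ← avgL_avgL, hf]

lemma hoeffdingProj_mem_hoeffdingComponent {f : Lp ℝ 2 (infinitePi μ)}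
    (hf : ∀ j ∉ A, avgL μ {j} f = f) :
    hoeffdingProj μ A f ∈ hoeffdingComponent (fun j => avgL μ {j}) A :=
  mem_hoeffdingComponent.2 ⟨fun _ hj => avgL_singleton_hoeffdingProj_of_mem hj f,
    fun _ hj => avgL_singleton_hoeffdingProj_of_fixed (hf _ hj)⟩

lemma norm_hoeffdingProj_le (f : Lp ℝ 2 (infinitePi μ)) :
    ‖hoeffdingProj μ A f‖ ≤ 2 ^ A.card * ‖f‖ := by
  rw [hoeffdingProj_apply]
  calc ‖∑ C ∈ A.powerset, ((-1 : ℝ) ^ C.card) • avgL μ C f‖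
      ≤ ∑ _ ∈ A.powerset, ‖f‖ := norm_sum_le_of_le _ fun C _ => by
        simpa [norm_smul] using norm_apply_le (isSymmetricProjection_avgL μ C) f
    _ = 2 ^ A.card * ‖f‖ := by simp

lemma avgL_singleton_toLp_of_update {j : ι} (hX : MemLp X 2 (infinitePi μ))
    (h : ∀ ω x, X (Function.update ω j x) = X ω) : avgL μ {j} hX.toLp = hX.toLp := by
  rw [avgL_toLp, MemLp.toLp_eq_toLp_iff]
  exact ae_of_all _ fun ω => by simp [avg, Finset.piecewise_singleton, h]

end Average

instance : IsProbabilityMeasure prob := by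
  unfold prob
  infer_instance

/-! ### Evaluation of a kernel at the jump times -/

/-- The half-open block `[2j, 2j+2)`. -/
def block (j : ℕ) : Set ℝ := Ico (2 * (j : ℝ)) (2 * (j : ℝ) + 2)

/-- A product of half-open blocks. -/
def box {m : ℕ} (k : Fin m → ℕ) : Set (Fin m → ℝ) := Set.pi univ fun i => block (k i)

/-- The point with coordinates `2kᵢ + 1 + U_{kᵢ}`. -/
def jumpTimes {m : ℕ} (k : Fin m → ℕ) (ω : Omega) : Fin m → ℝ :=
  fun i => 2 * (k i : ℝ) + 1 + ω (k i)

lemma measurableSet_block (j : ℕ) : MeasurableSet (block j) := measurableSet_Ico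

lemma measurableSet_box {m : ℕ} (k : Fin m → ℕ) : MeasurableSet (box k) :=
  MeasurableSet.univ_pi fun i => measurableSet_block (k i)

lemma measurable_jumpTimes {m : ℕ} (k : Fin m → ℕ) : Measurable (jumpTimes k) := by
  unfold jumpTimes
  fun_prop

lemma mem_block_iff {t : ℝ} (ht : 0 ≤ t) {j : ℕ} : t ∈ block j ↔ ⌊t / 2⌋₊ = j := by
  rw [Nat.floor_eq_iff (by positivity), block, mem_Ico]
  constructor <;> rintro ⟨hle, hlt⟩ <;> constructor <;> linarith

lemma block_subset_Ici (j : ℕ) : block j ⊆ Ici 0 := fun t ht =>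
  le_trans (by positivity) ht.1

lemma iUnion_block : ⋃ j, block j = Ici 0 := by
  ext t
  simp only [mem_iUnion]
  refine ⟨fun ⟨j, hj⟩ => block_subset_Ici j hj, fun ht => ⟨⌊t / 2⌋₊, (mem_block_iff ht).2 rfl⟩⟩

lemma eq_of_mem_block {t : ℝ} {i j : ℕ} (hi : t ∈ block i) (hj : t ∈ block j) : i = j := by
  rw [← (mem_block_iff (block_subset_Ici i hi)).1 hi,
    ← (mem_block_iff (block_subset_Ici j hj)).1 hj]

lemma pairwise_disjoint_block : Pairwise (Function.onFun Disjoint block) := fun _ _ hij =>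
  Set.disjoint_left.2 fun _ hi hj => hij (eq_of_mem_block hi hj)

lemma disjoint_box {m : ℕ} {k l : Fin m → ℕ} (h : k ≠ l) : Disjoint (box k) (box l) := by
  refine Set.disjoint_left.2 fun x hx hy => h ?_
  ext i
  exact eq_of_mem_block (hx i trivial) (hy i trivial)

lemma leb_restrict_block (j : ℕ) : leb.restrict (block j) = volume.restrict (block j) :=
  Measure.restrict_restrict_of_subset (block_subset_Ici j)

lemma unif_eq : unif = (2⁻¹ : ℝ≥0∞) • volume.restrict (Icc (-1 : ℝ) 1) := by
  rw [unif, ProbabilityTheory.cond, Real.volume_Icc]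
  congr
  norm_num

lemma map_unif (j : ℕ) :
    unif.map (fun u => 2 * (j : ℝ) + 1 + u) = (2⁻¹ : ℝ≥0∞) • volume.restrict (block j) := by
  have h := (measurePreserving_add_left (volume : Measure ℝ) (2 * (j : ℝ) + 1)).restrict_preimage
    (measurableSet_Icc (a := 2 * (j : ℝ)) (b := 2 * (j : ℝ) + 2))
  have e : (fun u => 2 * (j : ℝ) + 1 + u) ⁻¹' Icc (2 * (j : ℝ)) (2 * (j : ℝ) + 2)
      = Icc (-1 : ℝ) 1 := by
    ext u
    simp only [mem_preimage, mem_Icc]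
    constructor <;> rintro ⟨hle, hlt⟩ <;> constructor <;> linarith
  rw [e] at h
  rw [unif_eq, Measure.map_smul, h.map_eq, block, restrict_Ico_eq_restrict_Icc]

instance (j : ℕ) :
    IsProbabilityMeasure ((2⁻¹ : ℝ≥0∞) • (volume : Measure ℝ).restrict (block j)) := by
  rw [← map_unif]
  exact Measure.isProbabilityMeasure_map (by fun_prop)

lemma map_jumpTimes_eq_pi {m : ℕ} (k : Fin m ↪ ℕ) :
    prob.map (jumpTimes k)
      = Measure.pi fun i => (2⁻¹ : ℝ≥0∞) • volume.restrict (block (k i)) := by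
  symm
  refine Measure.pi_eq fun s hs => ?_
  let t : ℕ → Set ℝ := Function.extend k (fun i => (fun u => 2 * (k i : ℝ) + 1 + u) ⁻¹' s i)
    fun _ => univ
  have ht : ∀ i, t (k i) = (fun u => 2 * (k i : ℝ) + 1 + u) ⁻¹' s i := fun i =>
    k.injective.extend_apply _ _ i
  have hpre : jumpTimes k ⁻¹' (univ.pi s) = (↑(Finset.univ.map k) : Set ℕ).pi t := by
    ext ω
    simp [jumpTimes, Set.mem_pi, ht]
  have htm : ∀ j ∈ Finset.univ.map k, MeasurableSet (t j) := by
    simp only [Finset.mem_map, Finset.mem_univ, true_and, forall_exists_index,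
      forall_apply_eq_imp_iff, ht]
    exact fun i => (measurable_const_add _) (hs i)
  rw [Measure.map_apply (measurable_jumpTimes k) (MeasurableSet.univ_pi hs), hpre, prob,
    Measure.infinitePi_pi _ htm, Finset.prod_map]
  refine Finset.prod_congr rfl fun i _ => ?_
  rw [ht, ← map_unif, Measure.map_apply (by fun_prop) (hs i)]

lemma map_jumpTimes {m : ℕ} (k : Fin m ↪ ℕ) :
    prob.map (jumpTimes k) = ((2⁻¹ : ℝ≥0∞) ^ m) • (lebPi m).restrict (box k) := by
  rw [map_jumpTimes_eq_pi]
  refine Measure.pi_eq fun s _ => ?_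
  rw [lebPi, box, Measure.restrict_pi_pi, Measure.smul_apply, Measure.pi_pi]
  simp only [leb_restrict_block, Measure.smul_apply, smul_eq_mul, Finset.prod_mul_distrib,
    Finset.prod_const, Finset.card_univ, Fintype.card_fin]

lemma quasiMeasurePreserving_jumpTimes {m : ℕ} (k : Fin m ↪ ℕ) :
    Measure.QuasiMeasurePreserving (jumpTimes k) prob (lebPi m) := by
  refine ⟨measurable_jumpTimes k, ?_⟩
  rw [map_jumpTimes]
  exact (Measure.smul_absolutelyContinuous).trans Measure.restrict_le_self.absolutelyContinuous

section Kernel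

variable {n : ℕ}

lemma memLp_comp_jumpTimes (k : Fin n ↪ ℕ) {f : (Fin n → ℝ) → ℝ} {p : ℝ≥0∞}
    (hf : MemLp f p (lebPi n)) : MemLp (fun ω => f (jumpTimes k ω)) p prob := by
  have h : MemLp f p (prob.map (jumpTimes k)) := by
    rw [map_jumpTimes]
    exact (hf.restrict _).smul_measure (ENNReal.pow_ne_top (by simp))
  exact h.comp_of_map (measurable_jumpTimes k).aemeasurable

lemma integral_comp_jumpTimes (k : Fin n ↪ ℕ) {f : (Fin n → ℝ) → ℝ}
    (hf : AEStronglyMeasurable f (lebPi n)) :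
    ∫ ω, f (jumpTimes k ω) ∂prob = (1 / 2) ^ n * ∫ x in box k, f x ∂(lebPi n) := by
  have hf' : AEStronglyMeasurable f (prob.map (jumpTimes k)) := by
    rw [map_jumpTimes]
    exact hf.restrict.smul_measure _
  rw [← integral_map (measurable_jumpTimes k).aemeasurable hf', map_jumpTimes,
    integral_smul_measure]
  simp

/-- Evaluation of a kernel at the jump times, as an operator from `L²(ℝ₊ⁿ)` to `L²(Ω)`. -/
def evalJump (k : Fin n ↪ ℕ) : Lp ℝ 2 (lebPi n) →ₗ[ℝ] Lp ℝ 2 prob where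
  toFun f := (memLp_comp_jumpTimes k (Lp.memLp f)).toLp
  map_add' f g := by
    rw [← MemLp.toLp_add, MemLp.toLp_eq_toLp_iff]
    exact (quasiMeasurePreserving_jumpTimes k).ae_eq_comp (Lp.coeFn_add f g)
  map_smul' c f := by
    rw [RingHom.id_apply, ← MemLp.toLp_const_smul, MemLp.toLp_eq_toLp_iff]
    exact (quasiMeasurePreserving_jumpTimes k).ae_eq_comp (Lp.coeFn_smul c f)

lemma evalJump_toLp (k : Fin n ↪ ℕ) {f : (Fin n → ℝ) → ℝ} (hf : MemLp f 2 (lebPi n)) :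
    evalJump k hf.toLp = (memLp_comp_jumpTimes k hf).toLp := by
  simp only [evalJump, LinearMap.coe_mk, AddHom.coe_mk]
  rw [MemLp.toLp_eq_toLp_iff]
  exact (quasiMeasurePreserving_jumpTimes k).ae_eq_comp hf.coeFn_toLp

lemma norm_evalJump_sq (k : Fin n ↪ ℕ) (f : Lp ℝ 2 (lebPi n)) :
    ‖evalJump k f‖ ^ 2 = (1 / 2) ^ n * ∫ x in box k, f x ^ 2 ∂(lebPi n) := by
  rw [← integral_comp_jumpTimes k (f := fun x => f x ^ 2) ((Lp.aestronglyMeasurable f).pow 2)]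
  exact norm_toLp_sq (memLp_comp_jumpTimes k (Lp.memLp f))

instance {m : ℕ} : Countable (Fin m ↪ ℕ) := DFunLike.coe_injective.countable

lemma hasSum_setIntegral_box {f : (Fin n → ℝ) → ℝ} (hf : Integrable f (lebPi n)) :
    HasSum (fun k : Fin n ↪ ℕ => ∫ x in box k, f x ∂(lebPi n))
      (∫ x in ⋃ k : Fin n ↪ ℕ, box k, f x ∂(lebPi n)) :=
  hasSum_integral_iUnion (fun k => measurableSet_box k)
    (fun _ _ h => disjoint_box fun h' => h (DFunLike.coe_injective h')) hf.integrableOn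

lemma summable_norm_evalJump_sq (f : Lp ℝ 2 (lebPi n)) :
    Summable fun k : Fin n ↪ ℕ => ‖evalJump k f‖ ^ 2 := by
  simp only [norm_evalJump_sq]
  exact (hasSum_setIntegral_box (Lp.memLp f).integrable_sq).summable.mul_left _

lemma tsum_norm_evalJump_sq_le (f : Lp ℝ 2 (lebPi n)) :
    ∑' k : Fin n ↪ ℕ, ‖evalJump k f‖ ^ 2 ≤ ‖f‖ ^ 2 := by
  simp only [norm_evalJump_sq]
  rw [tsum_mul_left, (hasSum_setIntegral_box (Lp.memLp f).integrable_sq).tsum_eq,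
    norm_sq_eq_integral_sq]
  have hle : ∫ x in ⋃ k : Fin n ↪ ℕ, box k, f x ^ 2 ∂(lebPi n) ≤ ∫ x, f x ^ 2 ∂(lebPi n) :=
    setIntegral_le_integral (Lp.memLp f).integrable_sq (ae_of_all _ fun _ => sq_nonneg _)
  have hnonneg : (0 : ℝ) ≤ ∫ x in ⋃ k : Fin n ↪ ℕ, box k, f x ^ 2 ∂(lebPi n) :=
    integral_nonneg fun _ => sq_nonneg _
  exact (mul_le_of_le_one_left hnonneg (pow_le_one₀ (by norm_num) (by norm_num))).trans hle

/-! ### The multiple stochastic integral as an operator on `L²` -/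

/-- The set of indices of a tuple. -/
def indices (k : Fin n ↪ ℕ) : Finset ℕ := Finset.univ.map k

lemma card_indices (k : Fin n ↪ ℕ) : (indices k).card = n := by simp [indices]

lemma mem_indices {k : Fin n ↪ ℕ} {j : ℕ} : j ∈ indices k ↔ ∃ i, k i = j := by simp [indices]

lemma card_filter_indices_le (t : Finset (Fin n ↪ ℕ)) (u : Finset ℕ) :
    {k ∈ t | indices k = u}.card ≤ n ^ n := by
  by_cases hu : u.card = n
  · have h : {k ∈ t | indices k = u}.card ≤ (Fintype.piFinset fun _ : Fin n => u).card := by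
      refine Finset.card_le_card_of_injOn (fun k => ⇑k) (fun k hk => ?_)
        DFunLike.coe_injective.injOn
      rw [Finset.mem_coe, Finset.mem_filter] at hk
      exact Fintype.mem_piFinset.2 fun i => hk.2 ▸ mem_indices.2 ⟨i, rfl⟩
    simpa [hu] using h
  · rw [Finset.filter_false_of_mem fun k _ (h : indices k = u) => hu (h ▸ card_indices k)]
    exact Nat.zero_le _

lemma jumpTimes_update_of_notMem {k : Fin n ↪ ℕ} {j : ℕ} (hj : j ∉ indices k) (ω : Omega)
    (x : ℝ) : jumpTimes k (Function.update ω j x) = jumpTimes k ω := by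
  ext i
  have : k i ≠ j := fun h => hj (mem_indices.2 ⟨i, h⟩)
  simp [jumpTimes, this]

/-- The homogeneous chaos of order `n` of the uniform sequence. -/
abbrev uniformChaos (n : ℕ) : Submodule ℝ (Lp ℝ 2 prob) :=
  chaos (fun j => avgL (fun _ : ℕ => unif) {j}) n

/-- The completely degenerate part of a kernel evaluated at the jump times. -/
def chaosTerm (k : Fin n ↪ ℕ) : Lp ℝ 2 (lebPi n) →ₗ[ℝ] Lp ℝ 2 prob :=
  hoeffdingProj (fun _ : ℕ => unif) (indices k) ∘ₗ evalJump k

lemma chaosTerm_mem_hoeffdingComponent (f : Lp ℝ 2 (lebPi n)) (k : Fin n ↪ ℕ) :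
    chaosTerm k f ∈ hoeffdingComponent (fun j => avgL (fun _ : ℕ => unif) {j}) (indices k) :=
  hoeffdingProj_mem_hoeffdingComponent fun _ hj =>
    avgL_singleton_toLp_of_update (memLp_comp_jumpTimes k (Lp.memLp f)) fun ω x => by
      rw [jumpTimes_update_of_notMem hj]

lemma norm_chaosTerm_sq_le (k : Fin n ↪ ℕ) (f : Lp ℝ 2 (lebPi n)) :
    ‖chaosTerm k f‖ ^ 2 ≤ 4 ^ n * ‖evalJump k f‖ ^ 2 := by
  have hnorm : ‖chaosTerm k f‖ ≤ 2 ^ n * ‖evalJump k f‖ := by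
    have h := norm_hoeffdingProj_le (μ := fun _ => unif) (A := indices k) (evalJump k f)
    rwa [card_indices] at h
  calc ‖chaosTerm k f‖ ^ 2 ≤ (2 ^ n * ‖evalJump k f‖) ^ 2 := by gcongr
    _ = 4 ^ n * ‖evalJump k f‖ ^ 2 := by
        rw [mul_pow, ← pow_mul, mul_comm n 2, pow_mul]
        norm_num

lemma summable_norm_chaosTerm_sq (f : Lp ℝ 2 (lebPi n)) :
    Summable fun k : Fin n ↪ ℕ => ‖chaosTerm k f‖ ^ 2 :=
  Summable.of_nonneg_of_le (fun _ => by positivity) (fun k => norm_chaosTerm_sq_le k f)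
    ((summable_norm_evalJump_sq f).mul_left _)

lemma summable_chaosTerm (f : Lp ℝ 2 (lebPi n)) :
    Summable fun k : Fin n ↪ ℕ => chaosTerm k f :=
  summable_of_mem_hoeffdingComponent (fun j => isSymmetricProjection_avgL _ {j})
    (chaosTerm_mem_hoeffdingComponent f) card_filter_indices_le (summable_norm_chaosTerm_sq f)

/-- The multiple stochastic integral as an operator from `L²(ℝ₊ⁿ)` to `L²(Ω)`. -/
def multIntL (n : ℕ) : Lp ℝ 2 (lebPi n) →ₗ[ℝ] Lp ℝ 2 prob where
  toFun f := ∑' k : Fin n ↪ ℕ, chaosTerm k f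
  map_add' f g := by
    simp only [map_add]
    exact (summable_chaosTerm f).tsum_add (summable_chaosTerm g)
  map_smul' c f := by
    simp only [map_smul, RingHom.id_apply]
    exact (summable_chaosTerm f).tsum_const_smul c

lemma hasSum_multIntL (f : Lp ℝ 2 (lebPi n)) :
    HasSum (fun k : Fin n ↪ ℕ => chaosTerm k f) (multIntL n f) :=
  (summable_chaosTerm f).hasSum

lemma multIntL_mem_uniformChaos (f : Lp ℝ 2 (lebPi n)) : multIntL n f ∈ uniformChaos n :=
  tsum_mem_chaos (chaosTerm_mem_hoeffdingComponent f) card_indices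

lemma norm_multIntL_sq_le (f : Lp ℝ 2 (lebPi n)) :
    ‖multIntL n f‖ ^ 2 ≤ (n ^ n * 4 ^ n : ℝ) * ‖f‖ ^ 2 := by
  have hterms : ∑' k : Fin n ↪ ℕ, ‖chaosTerm k f‖ ^ 2 ≤ 4 ^ n * ‖f‖ ^ 2 :=
    calc ∑' k : Fin n ↪ ℕ, ‖chaosTerm k f‖ ^ 2
        ≤ ∑' k : Fin n ↪ ℕ, 4 ^ n * ‖evalJump k f‖ ^ 2 :=
          (summable_norm_chaosTerm_sq f).tsum_le_tsum (fun k => norm_chaosTerm_sq_le k f)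
            ((summable_norm_evalJump_sq f).mul_left _)
      _ ≤ 4 ^ n * ‖f‖ ^ 2 := by
          rw [tsum_mul_left]
          exact mul_le_mul_of_nonneg_left (tsum_norm_evalJump_sq_le f) (by positivity)
  calc ‖multIntL n f‖ ^ 2 ≤ (n ^ n : ℕ) * ∑' k : Fin n ↪ ℕ, ‖chaosTerm k f‖ ^ 2 :=
        norm_tsum_sq_le (fun j => isSymmetricProjection_avgL _ {j})
          (chaosTerm_mem_hoeffdingComponent f) card_filter_indices_le
          (summable_norm_chaosTerm_sq f)
    _ ≤ (n ^ n : ℕ) * (4 ^ n * ‖f‖ ^ 2) := by gcongr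
    _ = (n ^ n * 4 ^ n : ℝ) * ‖f‖ ^ 2 := by push_cast; ring

lemma continuous_multIntL : Continuous (multIntL n) := by
  refine ((multIntL n).mkContinuous √(n ^ n * 4 ^ n : ℝ) fun f => ?_).continuous
  rw [← Real.sqrt_sq (norm_nonneg f), ← Real.sqrt_mul (by positivity)]
  exact Real.le_sqrt_of_sq_le (norm_multIntL_sq_le f)

end Kernel

/-! ### The explicit formula and the chaos expansion agree -/

section Glue

variable {α : Type*} {n r : ℕ}

/-- The tuple whose first `r` entries are those of `x` and whose last ones are those of `y`. -/
def glue (n r : ℕ) (x : Fin r → α) (y : Fin (n - r) → α) : Fin n → α :=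
  fun i => if h : (i : ℕ) < r then x ⟨i, h⟩ else y ⟨(i : ℕ) - r, by have := i.isLt; omega⟩

/-- Positions of the first and of the last entries. -/
def splitEquiv (hr : r ≤ n) : Fin r ⊕ Fin (n - r) ≃ Fin n :=
  finSumFinEquiv.trans (finCongr (by omega))

lemma splitEquiv_inl (hr : r ≤ n) (i : Fin r) : (splitEquiv hr (Sum.inl i) : ℕ) = i := by
  simp [splitEquiv]

lemma splitEquiv_inr (hr : r ≤ n) (i : Fin (n - r)) : (splitEquiv hr (Sum.inr i) : ℕ) = r + i := by
  simp [splitEquiv]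

lemma glue_inl (hr : r ≤ n) (x : Fin r → α) (y : Fin (n - r) → α) (i : Fin r) :
    glue n r x y (splitEquiv hr (Sum.inl i)) = x i := by
  simp [glue, splitEquiv_inl]

lemma glue_inr (hr : r ≤ n) (x : Fin r → α) (y : Fin (n - r) → α) (i : Fin (n - r)) :
    glue n r x y (splitEquiv hr (Sum.inr i)) = y i := by
  simp [glue, splitEquiv_inr]

/-- Gluing as an equivalence, along which `lebPi n` is the product of `lebPi r` and
`lebPi (n - r)`. -/
def glueEquiv (hr : r ≤ n) : (Fin r → α) × (Fin (n - r) → α) ≃ (Fin n → α) where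
  toFun p := glue n r p.1 p.2
  invFun c := (fun i => c (splitEquiv hr (Sum.inl i)), fun i => c (splitEquiv hr (Sum.inr i)))
  left_inv p := by ext i <;> simp [glue_inl, glue_inr]
  right_inv c := by
    ext i
    obtain ⟨j, rfl⟩ := (splitEquiv hr).surjective i
    cases j with
    | inl j => exact glue_inl hr _ _ j
    | inr j => exact glue_inr hr _ _ j

lemma forall_fin_split (hr : r ≤ n) {p : Fin n → Prop} :
    (∀ i, p i) ↔ (∀ i, p (splitEquiv hr (Sum.inl i))) ∧ ∀ i, p (splitEquiv hr (Sum.inr i)) := by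
  rw [← (splitEquiv hr).forall_congr_right]
  simp only [Sum.forall]

lemma glue_mem_box (hr : r ≤ n) {k : Fin r → ℕ} {m : Fin (n - r) → ℕ} {x : Fin r → ℝ}
    {y : Fin (n - r) → ℝ} (hx : x ∈ box k) (hy : y ∈ box m) :
    glue n r x y ∈ box (glue n r k m) := by
  have := (forall_fin_split hr (p := fun i => glue n r x y i ∈ block (glue n r k m i))).2
    ⟨fun i => by rw [glue_inl, glue_inl]; exact hx i trivial,
      fun i => by rw [glue_inr, glue_inr]; exact hy i trivial⟩
  exact fun i _ => this i

lemma injective_of_glue_injective (hr : r ≤ n) {k : Fin r → α} {m : Fin (n - r) → α}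
    (h : Function.Injective (glue n r k m)) : Function.Injective k ∧ Function.Injective m := by
  refine ⟨fun i j hij => ?_, fun i j hij => ?_⟩
  · rw [← glue_inl hr k m, ← glue_inl hr k m] at hij
    simpa using h hij
  · rw [← glue_inr hr k m, ← glue_inr hr k m] at hij
    simpa using h hij

lemma measurable_glue (n r : ℕ) :
    Measurable fun p : (Fin r → ℝ) × (Fin (n - r) → ℝ) => glue n r p.1 p.2 := by
  refine measurable_pi_lambda _ fun i => ?_
  unfold glue
  split_ifs <;> fun_prop

lemma measurePreserving_glue (hr : r ≤ n) :
    MeasurePreserving (fun p : (Fin r → ℝ) × (Fin (n - r) → ℝ) => glue n r p.1 p.2)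
      ((lebPi r).prod (lebPi (n - r))) (lebPi n) := by
  refine ⟨measurable_glue n r, (Measure.pi_eq fun s hs => ?_).symm⟩
  rw [Measure.map_apply (measurable_glue n r) (MeasurableSet.univ_pi hs)]
  have e : (fun p : (Fin r → ℝ) × (Fin (n - r) → ℝ) => glue n r p.1 p.2) ⁻¹' univ.pi s
      = (univ.pi fun i => s (splitEquiv hr (Sum.inl i))) ×ˢ
        (univ.pi fun i => s (splitEquiv hr (Sum.inr i))) := by
    ext p
    simp only [mem_preimage, mem_univ_pi, mem_prod]
    rw [forall_fin_split hr]
    simp only [glue_inl, glue_inr]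
  rw [e, Measure.prod_prod, Measure.pi_pi, Measure.pi_pi, ← (splitEquiv hr).prod_comp,
    Fintype.prod_sum_type]

end Glue

section JumpGlue

lemma measurePreserving_jumpTimes_prod (n : ℕ) {r : ℕ} (k : Fin r ↪ ℕ) :
    MeasurePreserving (Prod.map (jumpTimes k) id) (prob.prod (lebPi (n - r)))
      ((prob.map (jumpTimes k)).prod (lebPi (n - r))) :=
  (measurable_jumpTimes k).measurePreserving prob |>.prod (MeasurePreserving.id _)

variable {n r : ℕ} (hr : r ≤ n) (k : Fin r ↪ ℕ)
include hr

lemma quasiMeasurePreserving_jumpTimes_glue :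
    Measure.QuasiMeasurePreserving
      (fun p : Omega × (Fin (n - r) → ℝ) => glue n r (jumpTimes k p.1) p.2)
      (prob.prod (lebPi (n - r))) (lebPi n) := by
  have hprod : Measure.QuasiMeasurePreserving (Prod.map (jumpTimes k) id)
      (prob.prod (lebPi (n - r))) ((lebPi r).prod (lebPi (n - r))) := by
    refine (measurePreserving_jumpTimes_prod n k).quasiMeasurePreserving.mono_right ?_
    exact (quasiMeasurePreserving_jumpTimes k).absolutelyContinuous.prod .rfl
  exact (measurePreserving_glue hr).quasiMeasurePreserving.comp hprod

lemma integrable_jumpTimes_glue {g : (Fin n → ℝ) → ℝ} (hg : Integrable g (lebPi n)) :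
    Integrable (fun p : Omega × (Fin (n - r) → ℝ) => g (glue n r (jumpTimes k p.1) p.2))
      (prob.prod (lebPi (n - r))) := by
  have hglue := (measurePreserving_glue hr).integrable_comp_of_integrable hg
  have hmap : Integrable (fun p : (Fin r → ℝ) × (Fin (n - r) → ℝ) => g (glue n r p.1 p.2))
      ((prob.map (jumpTimes k)).prod (lebPi (n - r))) := by
    rw [map_jumpTimes, Measure.prod_smul_left]
    refine Integrable.smul_measure ?_ (ENNReal.pow_ne_top (by simp))
    have hrestrict : ((lebPi r).restrict (box k)).prod (lebPi (n - r))
        = ((lebPi r).prod (lebPi (n - r))).restrict (box k ×ˢ univ) := by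
      rw [← Measure.prod_restrict, Measure.restrict_univ]
    rw [hrestrict]
    exact hglue.restrict
  exact (measurePreserving_jumpTimes_prod n k).integrable_comp_of_integrable hmap

end JumpGlue

lemma ae_ne_even {n : ℕ} : ∀ᵐ x ∂(lebPi n), ∀ i, ∀ j : ℕ, x i ≠ 2 * (j : ℝ) :=
  ae_all_iff.2 fun i => ae_all_iff.2 fun j => Measure.ae_eval_ne (fun _ => leb) i (2 * (j : ℝ))

lemma injective_of_mem_Delta {n : ℕ} {x : Fin n → ℝ} {c : Fin n → ℕ} (hx : x ∈ Delta n)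
    (hc : x ∈ box c) (hne : ∀ i, ∀ j : ℕ, x i ≠ 2 * (j : ℝ)) : Function.Injective c := by
  obtain ⟨k, hk⟩ := hx
  have : c = k := by
    ext i
    refine eq_of_mem_block (hc i trivial) ⟨(hk i).1, lt_of_le_of_ne (hk i).2 fun h => ?_⟩
    refine hne i (k i + 1) ?_
    push_cast
    linarith
  rw [this]
  exact k.injective

lemma ae_jumpTimes_mem_box {m : ℕ} (k : Fin m ↪ ℕ) : ∀ᵐ ω ∂prob, jumpTimes k ω ∈ box k := by
  refine ae_of_ae_map (measurable_jumpTimes k).aemeasurable ?_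
  rw [map_jumpTimes]
  exact Measure.ae_smul_measure (ae_restrict_mem (measurableSet_box k)) _

lemma ae_mem_iUnion_box (m : ℕ) : ∀ᵐ x ∂(lebPi m), x ∈ ⋃ c : Fin m → ℕ, box c := by
  have h : ∀ᵐ x ∂(lebPi m), ∀ i, 0 ≤ x i :=
    ae_all_iff.2 fun i => Measure.tendsto_eval_ae_ae.eventually
      (ae_restrict_mem (measurableSet_Ici (a := (0 : ℝ))))
  filter_upwards [h] with x hx
  exact mem_iUnion.2 ⟨fun i => ⌊x i / 2⌋₊, fun i _ => (mem_block_iff (hx i)).2 rfl⟩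

lemma hasSum_integral_box {m : ℕ} {h : (Fin m → ℝ) → ℝ} (hh : Integrable h (lebPi m)) :
    HasSum (fun c : Fin m → ℕ => ∫ y in box c, h y ∂(lebPi m)) (∫ y, h y ∂(lebPi m)) := by
  have := hasSum_integral_iUnion (fun c : Fin m → ℕ => measurableSet_box c)
    (fun _ _ h => disjoint_box h) hh.integrableOn
  rwa [Measure.restrict_eq_self_of_ae_mem (ae_mem_iUnion_box m)] at this

lemma tsum_embedding_eq_tsum {m : ℕ} {F : (Fin m → ℕ) → ℝ}
    (hF : ∀ c, ¬ Function.Injective c → F c = 0) : ∑' k : Fin m ↪ ℕ, F k = ∑' c, F c :=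
  Function.Injective.tsum_eq (g := fun k : Fin m ↪ ℕ => ⇑k) DFunLike.coe_injective fun c hc =>
    ⟨⟨c, by_contra fun h => hc (hF c h)⟩, rfl⟩

/-- The family `V` of numbers indexed by injective tuples, extended by zero to all tuples. -/
def zeroExtend {m : ℕ} (V : (Fin m ↪ ℕ) → ℝ) : (Fin m → ℕ) → ℝ :=
  Function.extend (fun k : Fin m ↪ ℕ => ⇑k) V 0

lemma zeroExtend_coe {m : ℕ} (V : (Fin m ↪ ℕ) → ℝ) (k : Fin m ↪ ℕ) : zeroExtend V k = V k :=
  Function.Injective.extend_apply (f := fun k : Fin m ↪ ℕ => (k : Fin m → ℕ))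
    DFunLike.coe_injective V 0 k

lemma zeroExtend_of_not_injective {m : ℕ} (V : (Fin m ↪ ℕ) → ℝ) {c : Fin m → ℕ}
    (hc : ¬ Function.Injective c) : zeroExtend V c = 0 :=
  Function.extend_apply' (f := fun k : Fin m ↪ ℕ => (k : Fin m → ℕ)) V 0 c
    fun ⟨k, hk⟩ => hc (hk ▸ k.injective)

lemma tsum_tsum_zeroExtend_glue {n r : ℕ} (hr : r ≤ n) {V : (Fin n ↪ ℕ) → ℝ} (hV : Summable V) :
    ∑' (k : Fin r ↪ ℕ) (m : Fin (n - r) → ℕ), zeroExtend V (glue n r k m) = ∑' c, V c := by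
  have hsum : Summable fun p : (Fin r → ℕ) × (Fin (n - r) → ℕ) => zeroExtend V (glue n r p.1 p.2) :=
    (glueEquiv hr).summable_iff.2 ((summable_extend_zero (g := fun k : Fin n ↪ ℕ => (k : Fin n → ℕ))
      DFunLike.coe_injective).2 hV)
  have hzero : ∀ k : Fin r → ℕ, ¬ Function.Injective k →
      ∑' m : Fin (n - r) → ℕ, zeroExtend V (glue n r k m) = 0 := fun k hk => by
    have h : ∀ m : Fin (n - r) → ℕ, zeroExtend V (glue n r k m) = 0 := fun m =>
      zeroExtend_of_not_injective V fun h => hk (injective_of_glue_injective hr h).1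
    simp only [h, tsum_zero]
  calc ∑' (k : Fin r ↪ ℕ) (m : Fin (n - r) → ℕ), zeroExtend V (glue n r k m)
      = ∑' (k : Fin r → ℕ) (m : Fin (n - r) → ℕ), zeroExtend V (glue n r k m) :=
        tsum_embedding_eq_tsum hzero
    _ = ∑' p : (Fin r → ℕ) × (Fin (n - r) → ℕ), zeroExtend V (glue n r p.1 p.2) :=
        (hsum.tsum_prod' fun k => hsum.comp_injective (Prod.mk_right_injective k)).symm
    _ = ∑' c, zeroExtend V c := (glueEquiv hr).tsum_eq (zeroExtend V)
    _ = ∑' c : Fin n ↪ ℕ, zeroExtend V c :=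
        (tsum_embedding_eq_tsum fun _ hc => zeroExtend_of_not_injective V hc).symm
    _ = ∑' c, V c := tsum_congr fun c => zeroExtend_coe V c

/-- The value of `f` at the jump times `c`, averaged over the coordinates in `A`. -/
def partialAvg {n : ℕ} (f : (Fin n → ℝ) → ℝ) (A : Finset (Fin n)) (c : Fin n ↪ ℕ) : Omega → ℝ :=
  avg (fun _ => unif) (A.map c) fun ω => f (jumpTimes c ω)

/-- The positions from `r` on: those of the variables integrated out in the `r`-th summand of
`I_n(f)`. -/
def tail (n r : ℕ) : Finset (Fin n) := {i | r ≤ (i : ℕ)}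

lemma card_tail {n r : ℕ} (hr : r ≤ n) : (tail n r).card = n - r := by
  have htail : tail n r = Finset.univ.map ⟨fun i : Fin (n - r) => splitEquiv hr (Sum.inr i),
      (splitEquiv hr).injective.comp Sum.inr_injective⟩ := by
    ext i
    obtain ⟨j, rfl⟩ := (splitEquiv hr).surjective i
    cases j with
    | inl j => simp [tail, splitEquiv_inl]
    | inr j => simp [tail, splitEquiv_inr]
  rw [htail, Finset.card_map, Finset.card_univ, Fintype.card_fin]

lemma glue_jumpTimes {n r : ℕ} (hr : r ≤ n) (c : Fin n ↪ ℕ) {k : Fin r → ℕ}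
    {m : Fin (n - r) → ℕ} (hc : ⇑c = glue n r k m) (ω ω' : Omega) :
    glue n r (jumpTimes k ω) (jumpTimes m ω')
      = jumpTimes c (((tail n r).map c).piecewise ω' ω) := by
  ext i
  obtain ⟨j, rfl⟩ := (splitEquiv hr).surjective i
  cases j with
  | inl j =>
    have h : c (splitEquiv hr (Sum.inl j)) = k j := by rw [hc, glue_inl]
    have hnotMem : k j ∉ (tail n r).map c := by
      rw [← h]
      simp [tail, splitEquiv_inl]
    rw [glue_inl, jumpTimes, jumpTimes, h,
      Finset.piecewise_eq_of_notMem _ _ _ hnotMem]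
  | inr j =>
    have h : c (splitEquiv hr (Sum.inr j)) = m j := by rw [hc, glue_inr]
    have hmem : m j ∈ (tail n r).map c := by
      rw [← h]
      simp [tail, splitEquiv_inr]
    rw [glue_inr, jumpTimes, jumpTimes, h,
      Finset.piecewise_eq_of_mem _ _ _ hmem]

section Kernel

variable {n : ℕ} {g : (Fin n → ℝ) → ℝ}

lemma ae_setIntegral_box_of_injective {r : ℕ} (hr : r ≤ n)
    (hg : Integrable g (lebPi n)) (k : Fin r ↪ ℕ) (m : Fin (n - r) → ℕ) (c : Fin n ↪ ℕ)
    (hc : ⇑c = glue n r k m) :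
    ∀ᵐ ω ∂prob, ∫ y in box m, g (glue n r (jumpTimes k ω) y) ∂(lebPi (n - r))
      = 2 ^ (n - r) * partialAvg g (tail n r) c ω := by
  have hm : Function.Injective m :=
    (injective_of_glue_injective hr (hc ▸ c.injective)).2
  filter_upwards [(integrable_jumpTimes_glue hr k hg).prod_right_ae] with ω hω
  have h := integral_comp_jumpTimes ⟨m, hm⟩ hω.1
  simp only [Function.Embedding.coeFn_mk] at h
  have havg : partialAvg g (tail n r) c ω
      = ∫ ω', g (glue n r (jumpTimes k ω) (jumpTimes m ω')) ∂prob := by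
    simp only [glue_jumpTimes hr c hc]
    rfl
  rw [havg, h, ← mul_assoc, ← mul_pow]
  norm_num

lemma ae_setIntegral_box_of_not_injective {r : ℕ} (hr : r ≤ n) (hg : HatL2 n g) (k : Fin r ↪ ℕ)
    (m : Fin (n - r) → ℕ) (hc : ¬ Function.Injective (glue n r k m)) :
    ∀ᵐ ω ∂prob, ∫ y in box m, g (glue n r (jumpTimes k ω) y) ∂(lebPi (n - r)) = 0 := by
  have hvanish := Measure.ae_ae_of_ae_prod ((quasiMeasurePreserving_jumpTimes_glue hr k).ae
    (hg.vanish.and ae_ne_even))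
  filter_upwards [hvanish, ae_jumpTimes_mem_box k] with ω hω hbox
  refine integral_eq_zero_of_ae ?_
  filter_upwards [ae_restrict_of_ae hω, ae_restrict_mem (measurableSet_box m)] with y hy hym
  refine hy.1 fun hD => hc ?_
  exact injective_of_mem_Delta hD (glue_mem_box hr hbox hym) hy.2

lemma integrable_partialAvg (hg : Integrable g (lebPi n)) (A : Finset (Fin n)) (c : Fin n ↪ ℕ) :
    Integrable (partialAvg g A c) prob :=
  integrable_avg _ (memLp_one_iff_integrable.1
    (memLp_comp_jumpTimes c (memLp_one_iff_integrable.2 hg)))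

lemma integral_norm_partialAvg_le (hg : Integrable g (lebPi n)) (A : Finset (Fin n))
    (c : Fin n ↪ ℕ) :
    ∫ ω, ‖partialAvg g A c ω‖ ∂prob ≤ (1 / 2) ^ n * ∫ x in box c, ‖g x‖ ∂(lebPi n) := by
  have hI : Integrable (fun ω => g (jumpTimes c ω)) prob := memLp_one_iff_integrable.1
    (memLp_comp_jumpTimes c (memLp_one_iff_integrable.2 hg))
  calc ∫ ω, ‖partialAvg g A c ω‖ ∂prob
      ≤ ∫ ω, avg (fun _ => unif) (A.map c) (fun ω => ‖g (jumpTimes c ω)‖) ω ∂prob :=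
        integral_mono (integrable_partialAvg hg A c).norm (integrable_avg _ hI.norm) fun _ =>
          norm_integral_le_integral_norm _
    _ = ∫ ω, ‖g (jumpTimes c ω)‖ ∂prob := integral_avg (A.map c) hI.norm
    _ = (1 / 2) ^ n * ∫ x in box c, ‖g x‖ ∂(lebPi n) := integral_comp_jumpTimes c hg.norm.1

lemma ae_summable_partialAvg (hg : Integrable g (lebPi n)) (A : Finset (Fin n)) :
    ∀ᵐ ω ∂prob, Summable fun c : Fin n ↪ ℕ => partialAvg g A c ω := by
  have h := summable_norm_of_tsum_eLpNorm_ne_top (p := 1) le_rfl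
    (f := fun c : Fin n ↪ ℕ => partialAvg g A c)
    (fun c => (integrable_partialAvg hg A c).1) (μ := prob) ?_
  · filter_upwards [h] with ω hω using hω.of_norm
  · have heLpNorm : ∀ c : Fin n ↪ ℕ, eLpNorm (partialAvg g A c) 1 prob
        = ENNReal.ofReal (∫ ω, ‖partialAvg g A c ω‖ ∂prob) := fun c => by
      rw [eLpNorm_one_eq_lintegral_enorm,
        ← ofReal_integral_norm_eq_lintegral_enorm (integrable_partialAvg hg A c)]
    simp only [heLpNorm]
    rw [← ENNReal.ofReal_tsum_of_nonneg (fun c => integral_nonneg fun _ => norm_nonneg _)]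
    · exact ENNReal.ofReal_ne_top
    · exact Summable.of_nonneg_of_le (fun c => integral_nonneg fun _ => norm_nonneg _)
        (integral_norm_partialAvg_le hg A) ((hasSum_setIntegral_box hg.norm).summable.mul_left _)

lemma ae_setIntegral_box_eq {r : ℕ} (hr : r ≤ n) (hg : HatL2 n g) (hI : Integrable g (lebPi n))
    (k : Fin r ↪ ℕ) (m : Fin (n - r) → ℕ) :
    ∀ᵐ ω ∂prob, ∫ y in box m, g (glue n r (jumpTimes k ω) y) ∂(lebPi (n - r))
      = zeroExtend (fun c => 2 ^ (n - r) * partialAvg g (tail n r) c ω) (glue n r k m) := by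
  by_cases h : Function.Injective (glue n r k m)
  · filter_upwards [ae_setIntegral_box_of_injective hr hI k m ⟨_, h⟩ rfl] with ω hω
    rw [hω]
    exact (zeroExtend_coe (fun c => 2 ^ (n - r) * partialAvg g (tail n r) c ω) ⟨_, h⟩).symm
  · filter_upwards [ae_setIntegral_box_of_not_injective hr hg k m h] with ω hω
    rw [hω, zeroExtend_of_not_injective _ h]

lemma ae_tsum_integral_jumpPoint {r : ℕ} (hr : r ≤ n) (hg : HatL2 n g)
    (hI : Integrable g (lebPi n)) :
    ∀ᵐ ω ∂prob, ∑' k : Fin r ↪ ℕ, ∫ y, g (jumpPoint n r k y ω) ∂(lebPi (n - r))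
      = 2 ^ (n - r) * ∑' c : Fin n ↪ ℕ, partialAvg g (tail n r) c ω := by
  have hbox := ae_all_iff.2 fun k => ae_all_iff.2 fun m => ae_setIntegral_box_eq hr hg hI k m
  have hint : ∀ᵐ ω ∂prob, ∀ k : Fin r ↪ ℕ,
      Integrable (fun y => g (glue n r (jumpTimes k ω) y)) (lebPi (n - r)) :=
    ae_all_iff.2 fun k => (integrable_jumpTimes_glue hr k hI).prod_right_ae
  filter_upwards [hbox, hint, ae_summable_partialAvg hI (tail n r)] with ω hbox hint hsum
  calc ∑' k : Fin r ↪ ℕ, ∫ y, g (jumpPoint n r k y ω) ∂(lebPi (n - r))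
      = ∑' (k : Fin r ↪ ℕ) (m : Fin (n - r) → ℕ),
          ∫ y in box m, g (glue n r (jumpTimes k ω) y) ∂(lebPi (n - r)) :=
        tsum_congr fun k => (hasSum_integral_box (hint k)).tsum_eq.symm
    _ = ∑' c : Fin n ↪ ℕ, 2 ^ (n - r) * partialAvg g (tail n r) c ω := by
        simp only [hbox]
        exact tsum_tsum_zeroExtend_glue hr (hsum.mul_left _)
    _ = 2 ^ (n - r) * ∑' c : Fin n ↪ ℕ, partialAvg g (tail n r) c ω := tsum_mul_left

lemma exists_perm_map_eq {A B : Finset (Fin n)} (h : A.card = B.card) :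
    ∃ σ : Equiv.Perm (Fin n), A.map σ.toEmbedding = B := by
  classical
  let e := Finset.equivOfCardEq h
  refine ⟨e.extendSubtype, Finset.eq_of_subset_of_card_le (fun x hx => ?_) (by simp [h])⟩
  rw [Finset.mem_map] at hx
  obtain ⟨y, hy, rfl⟩ := hx
  exact e.extendSubtype_mem y hy

lemma ae_partialAvg_perm (hg : HatL2 n g) (A : Finset (Fin n)) (σ : Equiv.Perm (Fin n))
    (c : Fin n ↪ ℕ) :
    partialAvg g A (σ.toEmbedding.trans c) =ᵐ[prob] partialAvg g (A.map σ.toEmbedding) c := by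
  rw [partialAvg, partialAvg, ← Finset.map_map]
  exact avg_congr _ ((quasiMeasurePreserving_jumpTimes c).ae_eq_comp (hg.symm σ))

lemma ae_tsum_partialAvg_eq_of_card (hg : HatL2 n g) {A B : Finset (Fin n)}
    (h : A.card = B.card) : ∀ᵐ ω ∂prob,
      ∑' c : Fin n ↪ ℕ, partialAvg g A c ω = ∑' c : Fin n ↪ ℕ, partialAvg g B c ω := by
  obtain ⟨σ, rfl⟩ := exists_perm_map_eq h
  filter_upwards [ae_all_iff.2 fun c => ae_partialAvg_perm hg A σ c] with ω hω
  rw [← (Equiv.embeddingCongr σ.symm (Equiv.refl ℕ)).tsum_eq]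
  exact tsum_congr hω

lemma ae_multIntL1_eq_sum (hg : HatL2 n g) (hI : Integrable g (lebPi n)) :
    ∀ᵐ ω ∂prob, multIntL1 n g ω = ∑ A ∈ (Finset.univ : Finset (Fin n)).powerset,
      (-1 : ℝ) ^ A.card * ∑' c : Fin n ↪ ℕ, partialAvg g A c ω := by
  have hjump : ∀ᵐ ω ∂prob, ∀ r, r ≤ n →
      ∑' k : Fin r ↪ ℕ, ∫ y, g (jumpPoint n r k y ω) ∂(lebPi (n - r))
        = 2 ^ (n - r) * ∑' c : Fin n ↪ ℕ, partialAvg g (tail n r) c ω := by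
    simp only [ae_all_iff]
    exact fun r hr => ae_tsum_integral_jumpPoint hr hg hI
  have htail : ∀ᵐ ω ∂prob, ∀ A : Finset (Fin n), ∑' c : Fin n ↪ ℕ, partialAvg g A c ω
      = ∑' c : Fin n ↪ ℕ, partialAvg g (tail n (n - A.card)) c ω := by
    refine ae_all_iff.2 fun A => ae_tsum_partialAvg_eq_of_card hg ?_
    have hA : A.card ≤ n := by simpa using A.card_le_univ
    rw [card_tail (Nat.sub_le _ _), Nat.sub_sub_self hA]
  filter_upwards [hjump, htail] with ω hjump htail
  let Q : ℕ → ℝ := fun s => (-1 : ℝ) ^ s * ∑' c : Fin n ↪ ℕ, partialAvg g (tail n (n - s)) c ω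
  have hQ : ∀ r ∈ Finset.range (n + 1), (-1 : ℝ) ^ (n - r) / 2 ^ (n - r) * (n.choose r : ℝ) *
      ∑' k : Fin r ↪ ℕ, ∫ y, g (jumpPoint n r k y ω) ∂(lebPi (n - r))
        = n.choose (n - r) • Q (n - r) := fun r hr => by
    have hr : r ≤ n := by simpa [Nat.lt_succ_iff] using hr
    rw [hjump r hr, Nat.choose_symm hr, nsmul_eq_mul]
    simp only [Q, Nat.sub_sub_self hr]
    field_simp
  calc multIntL1 n g ω = ∑ s ∈ Finset.range (n + 1), n.choose s • Q s := by
        rw [multIntL1, Finset.sum_congr rfl hQ]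
        exact Finset.sum_flip fun s => n.choose s • Q s
    _ = ∑ A ∈ (Finset.univ : Finset (Fin n)).powerset, Q A.card := by
        rw [Finset.sum_powerset_apply_card, Finset.card_univ, Fintype.card_fin]
    _ = _ := Finset.sum_congr rfl fun A _ => by rw [htail A]

/-- The summand of the multiple stochastic integral attached to a tuple, as a function. -/
def chaosFun (g : (Fin n → ℝ) → ℝ) (c : Fin n ↪ ℕ) (ω : Omega) : ℝ :=
  ∑ A ∈ (Finset.univ : Finset (Fin n)).powerset, (-1 : ℝ) ^ A.card * partialAvg g A c ω

lemma ae_hasSum_chaosFun (hg : HatL2 n g) (hI : Integrable g (lebPi n)) :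
    ∀ᵐ ω ∂prob, HasSum (fun c => chaosFun g c ω) (multIntL1 n g ω) := by
  filter_upwards [ae_multIntL1_eq_sum hg hI,
    ae_all_iff.2 fun A => ae_summable_partialAvg hI A] with ω heq hsum
  rw [heq]
  exact hasSum_sum fun A _ => (hsum A).hasSum.mul_left _

lemma chaosTerm_toLp (hg : MemLp g 2 (lebPi n)) (c : Fin n ↪ ℕ) :
    chaosTerm c hg.toLp =ᵐ[prob] chaosFun g c := by
  have hterm : chaosTerm c hg.toLp =ᵐ[prob] fun ω => ∑ C ∈ (indices c).powerset,
      (-1 : ℝ) ^ C.card * avg (fun _ => unif) C (fun ω => g (jumpTimes c ω)) ω :=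
    (congrArg (hoeffdingProj _ _) (evalJump_toLp c hg)).symm ▸
      coeFn_hoeffdingProj_toLp (indices c) (memLp_comp_jumpTimes c hg)
  filter_upwards [hterm] with ω hω
  rw [hω, indices, Finset.map_eq_image, Finset.powerset_image,
    Finset.sum_image (Finset.image_injective c.injective).injOn]
  refine Finset.sum_congr rfl fun A _ => ?_
  rw [Finset.card_image_of_injective _ c.injective, partialAvg, Finset.map_eq_image]

theorem multIntL1_ae_eq (hg : HatL2 n g) (hI : Integrable g (lebPi n)) :
    multIntL1 n g =ᵐ[prob] multIntL n hg.memLp.toLp := by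
  obtain ⟨s, hs⟩ := Filter.exists_seq_tendsto (atTop : Filter (Finset (Fin n ↪ ℕ)))
  let S : ℕ → Lp ℝ 2 prob := fun N => ∑ c ∈ s N, chaosTerm c hg.memLp.toLp
  have hL2 : TendstoInMeasure prob (fun N => ⇑(S N)) atTop (multIntL n hg.memLp.toLp) :=
    tendstoInMeasure_of_tendsto_Lp ((hasSum_multIntL hg.memLp.toLp).comp hs)
  have hS : ∀ N, S N =ᵐ[prob] fun ω => ∑ c ∈ s N, chaosFun g c ω := fun N => by
    filter_upwards [Lp.coeFn_finsetSum (s N) fun c => chaosTerm c hg.memLp.toLp,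
      ae_all_iff.2 fun c => chaosTerm_toLp hg.memLp c] with ω hsum hterm
    rw [hsum, Finset.sum_apply]
    exact Finset.sum_congr rfl fun c _ => hterm c
  have hae : TendstoInMeasure prob (fun N => ⇑(S N)) atTop (multIntL1 n g) := by
    refine tendstoInMeasure_of_tendsto_ae (fun N => Lp.aestronglyMeasurable _) ?_
    filter_upwards [ae_all_iff.2 hS, ae_hasSum_chaosFun hg hI] with ω hS hsum
    simp only [hS]
    exact hsum.comp hs
  exact tendstoInMeasure_ae_unique hae hL2

end Kernel

/-! ### The extension of the multiple stochastic integral to all square-integrable kernels -/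

section Extension

variable {n : ℕ} {f : (Fin n → ℝ) → ℝ}

/-- The cube `(-∞, m)ⁿ`, which has finite measure with respect to Lebesgue measure on `ℝ₊ⁿ`. -/
def cube (n m : ℕ) : Set (Fin n → ℝ) := univ.pi fun _ => Iio (m : ℝ)

/-- The restriction of a kernel to a cube; it approximates a square-integrable kernel by integrable
ones. -/
def truncate (f : (Fin n → ℝ) → ℝ) (m : ℕ) : (Fin n → ℝ) → ℝ := (cube n m).indicator f

lemma measurableSet_cube (n m : ℕ) : MeasurableSet (cube n m) :=
  MeasurableSet.univ_pi fun _ => measurableSet_Iio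

lemma comp_perm_mem_cube_iff {m : ℕ} (σ : Equiv.Perm (Fin n)) {x : Fin n → ℝ} :
    x ∘ σ ∈ cube n m ↔ x ∈ cube n m := by
  simp only [cube, mem_univ_pi, Function.comp_apply]
  exact σ.forall_congr_right (q := fun i => x i ∈ Iio (m : ℝ))

lemma eventually_mem_cube (x : Fin n → ℝ) : ∀ᶠ m in atTop, x ∈ cube n m := by
  simp only [cube, mem_univ_pi, mem_Iio]
  exact eventually_all.2 fun i => tendsto_natCast_atTop_atTop.eventually_gt_atTop (x i)

lemma memLp_truncate (hf : MemLp f 2 (lebPi n)) (m : ℕ) : MemLp (truncate f m) 2 (lebPi n) :=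
  hf.indicator (measurableSet_cube n m)

lemma hatL2_truncate (hf : HatL2 n f) (m : ℕ) : HatL2 n (truncate f m) where
  memLp := memLp_truncate hf.memLp m
  symm σ := by
    classical
    filter_upwards [hf.symm σ] with x hx
    simp only [truncate, indicator_apply, comp_perm_mem_cube_iff, hx]
  vanish := by
    classical
    filter_upwards [hf.vanish] with x hx hD
    rw [truncate, indicator_apply, hx hD, ite_self]

lemma integrable_truncate (hf : MemLp f 2 (lebPi n)) (m : ℕ) :
    Integrable (truncate f m) (lebPi n) := by
  have : IsFiniteMeasure ((lebPi n).restrict (cube n m)) := by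
    refine ⟨?_⟩
    rw [Measure.restrict_apply_univ, lebPi, cube, Measure.pi_pi]
    refine ENNReal.prod_lt_top fun i _ => ?_
    rw [Measure.restrict_apply measurableSet_Iio, Iio_inter_Ici]
    simp
  rw [truncate, integrable_indicator_iff (measurableSet_cube n m)]
  exact (hf.restrict _).integrable (by norm_num)

lemma tendsto_integral_sq_truncate_sub (hf : MemLp f 2 (lebPi n)) :
    Tendsto (fun m => ∫ x, (truncate f m x - f x) ^ 2 ∂(lebPi n)) atTop (𝓝 0) := by
  classical
  have h := tendsto_integral_of_dominated_convergence (μ := lebPi n) (f := fun _ => (0 : ℝ))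
    (F := fun m x => (truncate f m x - f x) ^ 2) (fun x => f x ^ 2)
    (fun m => ((memLp_truncate hf m).1.sub hf.1).pow 2) hf.integrable_sq
    (fun m => ae_of_all _ fun x => ?_) (ae_of_all _ fun x => ?_)
  · simpa only [integral_zero] using h
  · rw [Real.norm_of_nonneg (sq_nonneg _), truncate, indicator_apply]
    split_ifs
    · simpa using sq_nonneg _
    · simp
  · refine tendsto_const_nhds.congr' ?_
    filter_upwards [eventually_mem_cube x] with m hm
    simp [truncate, indicator_of_mem hm]

lemma tendsto_eLpNorm_truncate (hf : MemLp f 2 (lebPi n)) :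
    Tendsto (fun m => eLpNorm (fun x => truncate f m x - f x) 2 (lebPi n)) atTop (𝓝 0) := by
  have h := ENNReal.tendsto_ofReal (tendsto_integral_sq_truncate_sub hf).sqrt
  rw [Real.sqrt_zero, ENNReal.ofReal_zero] at h
  refine h.congr fun m => ?_
  have hm : MemLp (fun x => truncate f m x - f x) 2 (lebPi n) :=
    (memLp_truncate hf m).sub hf
  rw [← norm_toLp_sq hm, Real.sqrt_sq (norm_nonneg _), Lp.norm_toLp,
    ENNReal.ofReal_toReal hm.2.ne]

lemma tendsto_multIntL (hf : HatL2 n f) {g : ℕ → (Fin n → ℝ) → ℝ} (hg : ∀ m, HatL2 n (g m))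
    (h : Tendsto (fun m => eLpNorm (fun x => g m x - f x) 2 (lebPi n)) atTop (𝓝 0)) :
    Tendsto (fun m => multIntL n (hg m).memLp.toLp) atTop (𝓝 (multIntL n hf.memLp.toLp)) :=
  (continuous_multIntL.tendsto _).comp
    ((Lp.tendsto_Lp_iff_tendsto_eLpNorm'' g (fun m => (hg m).memLp) f hf.memLp).2 h)

theorem isMultInt_iff (hf : HatL2 n f) {X : Omega → ℝ} :
    IsMultInt n f X ↔ X =ᵐ[prob] multIntL n hf.memLp.toLp := by
  constructor
  · rintro ⟨hX, g, hg, hgf, hgX⟩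
    have hlim : Tendsto (fun m => multIntL n (hg m).1.memLp.toLp) atTop (𝓝 hX.toLp) := by
      refine (Lp.tendsto_Lp_iff_tendsto_eLpNorm _ X hX).2 (hgX.congr fun m => ?_)
      exact eLpNorm_congr_ae ((multIntL1_ae_eq (hg m).1 (hg m).2).sub EventuallyEq.rfl)
    rw [← tendsto_nhds_unique hlim (tendsto_multIntL hf (fun m => (hg m).1) hgf)]
    exact hX.coeFn_toLp.symm
  · intro hX
    have htrunc m := integrable_truncate hf.memLp m
    have hlim := tendsto_multIntL hf (hatL2_truncate hf) (tendsto_eLpNorm_truncate hf.memLp)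
    refine ⟨(Lp.memLp _).ae_eq hX.symm, truncate f, fun m => ⟨hatL2_truncate hf m, htrunc m⟩,
      tendsto_eLpNorm_truncate hf.memLp,
      ((Lp.tendsto_Lp_iff_tendsto_eLpNorm' _ _).1 hlim).congr fun m => ?_⟩
    exact eLpNorm_congr_ae ((multIntL1_ae_eq (hatL2_truncate hf m) (htrunc m)).symm.sub hX.symm)

end Extension

/-! ### Resampling one coordinate -/

lemma integral_const_sub_sq {α : Type*} [MeasurableSpace α] {μ : Measure α}
    [IsProbabilityMeasure μ] {a : α → ℝ} (ha : MemLp a 2 μ) (ha0 : ∫ u, a u ∂μ = 0) (c : ℝ) :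
    ∫ v, (c - a v) ^ 2 ∂μ = c ^ 2 + ∫ v, a v ^ 2 ∂μ := by
  have hlin : Integrable (fun v => 2 * c * a v) μ := (ha.integrable (by norm_num)).const_mul _
  have hexpand : ∀ v, (c - a v) ^ 2 = c ^ 2 - 2 * c * a v + a v ^ 2 := fun v => by ring
  have hquad : Integrable (fun v => c ^ 2 - 2 * c * a v) μ := (integrable_const _).sub hlin
  simp only [hexpand]
  rw [integral_add hquad ha.integrable_sq,
    integral_sub (integrable_const _) hlin, integral_const_mul, ha0]
  simp

lemma lintegral_lintegral_abs_mul_sub_sq {α : Type*} [MeasurableSpace α] {μ : Measure α}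
    [IsProbabilityMeasure μ] {a : α → ℝ} (ha : MemLp a 2 μ) (ha0 : ∫ u, a u ∂μ = 0) :
    ∫⁻ u, ∫⁻ v, ENNReal.ofReal (|a u| * (a u - a v) ^ 2) ∂μ ∂μ
      = ∫⁻ u, ENNReal.ofReal (|a u| ^ 3) ∂μ
        + (∫⁻ u, ENNReal.ofReal |a u| ∂μ) * ∫⁻ u, ENNReal.ofReal (|a u| ^ 2) ∂μ := by
  have hvar : ∫⁻ u, ENNReal.ofReal (|a u| ^ 2) ∂μ = ENNReal.ofReal (∫ u, a u ^ 2 ∂μ) := by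
    simp only [sq_abs]
    exact (ofReal_integral_eq_lintegral_ofReal ha.integrable_sq
      (ae_of_all _ fun _ => sq_nonneg _)).symm
  have hinner : ∀ u, ∫⁻ v, ENNReal.ofReal (|a u| * (a u - a v) ^ 2) ∂μ
      = ENNReal.ofReal (|a u| ^ 3)
        + ENNReal.ofReal |a u| * ∫⁻ u, ENNReal.ofReal (|a u| ^ 2) ∂μ := fun u => by
    have hsub : MemLp (fun v => a u - a v) 2 μ := (memLp_const (a u)).sub ha
    rw [← ofReal_integral_eq_lintegral_ofReal (hsub.integrable_sq.const_mul _)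
        (ae_of_all _ fun _ => by positivity), integral_const_mul,
      integral_const_sub_sq ha ha0, hvar, ← ENNReal.ofReal_mul (abs_nonneg _),
      ← ENNReal.ofReal_add (by positivity) (by positivity), mul_add, ← sq_abs (a u), ← pow_succ']
  have habs : AEMeasurable (fun u => |a u|) μ := ha.1.aemeasurable.abs
  simp only [hinner]
  rw [lintegral_add_left' (habs.pow_const 3).ennreal_ofReal,
    lintegral_mul_const'' _ habs.ennreal_ofReal]

section Coordinate

open MeasureTheory.Measure (infinitePi)

variable {ι : Type*} [DecidableEq ι] {Ω : ι → Type*} [∀ i, MeasurableSpace (Ω i)]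
  (μ : ∀ i, Measure (Ω i))

/-- The average of `X` over the coordinate `j`: the conditional expectation of `X` given all the
other coordinates. -/
def coordAvg (X : (∀ i, Ω i) → ℝ) (j : ι) (ω : ∀ i, Ω i) : ℝ :=
  ∫ u, X (Function.update ω j u) ∂μ j

/-- The centred dependence of `X` on the coordinate `j`, as a function of the value `u` given to
that coordinate. -/
def coordDiff (X : (∀ i, Ω i) → ℝ) (j : ι) (ω : ∀ i, Ω i) (u : Ω j) : ℝ :=
  X (Function.update ω j u) - coordAvg μ X j ω

/-- The conditional variance of `X` given all coordinates but the one of index `j`. -/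
def coordVar (X : (∀ i, Ω i) → ℝ) (j : ι) (ω : ∀ i, Ω i) : ℝ :=
  ∫ u, coordDiff μ X j ω u ^ 2 ∂μ j

/-- The error term of the expansion of a function of `X` in the coordinate `j`: the integral of
`|d(u)| (d(u) - d(v))²` over `u` and `v`, where `d` is `coordDiff μ X j ω`. -/
def coordRem (X : (∀ i, Ω i) → ℝ) (j : ι) (ω : ∀ i, Ω i) : ℝ≥0∞ :=
  ∫⁻ u, ENNReal.ofReal (|coordDiff μ X j ω u| ^ 3) ∂μ j
    + (∫⁻ u, ENNReal.ofReal |coordDiff μ X j ω u| ∂μ j)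
      * ∫⁻ u, ENNReal.ofReal (|coordDiff μ X j ω u| ^ 2) ∂μ j

lemma coordVar_nonneg (X : (∀ i, Ω i) → ℝ) (j : ι) (ω : ∀ i, Ω i) : 0 ≤ coordVar μ X j ω :=
  integral_nonneg fun _ => sq_nonneg _

lemma coordAvg_update (X : (∀ i, Ω i) → ℝ) (j : ι) (ω : ∀ i, Ω i) (v : Ω j) :
    coordAvg μ X j (Function.update ω j v) = coordAvg μ X j ω := by
  simp only [coordAvg, Function.update_idem]

lemma coordDiff_update (X : (∀ i, Ω i) → ℝ) (j : ι) (ω : ∀ i, Ω i) (v : Ω j) :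
    coordDiff μ X j (Function.update ω j v) = coordDiff μ X j ω := by
  ext u
  simp only [coordDiff, coordAvg_update, Function.update_idem]

variable [∀ i, IsProbabilityMeasure (μ i)]

lemma measurePreserving_update (j : ι) :
    MeasurePreserving (fun p : (∀ i, Ω i) × Ω j => Function.update p.1 j p.2)
      ((infinitePi μ).prod (μ j)) (infinitePi μ) := by
  have heval : MeasurePreserving (Prod.map id fun ω : ∀ i, Ω i => ω j)
      ((infinitePi μ).prod (infinitePi μ)) ((infinitePi μ).prod (μ j)) :=
    (MeasurePreserving.id _).prod (measurePreserving_eval_infinitePi μ j)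
  refine ⟨measurable_update', ?_⟩
  calc ((infinitePi μ).prod (μ j)).map (fun p => Function.update p.1 j p.2)
      = ((infinitePi μ).prod (infinitePi μ)).map
          (fun p => ({j} : Finset ι).piecewise p.2 p.1) := by
        rw [← heval.map_eq, Measure.map_map measurable_update' heval.measurable]
        simp only [Finset.piecewise_singleton]
        rfl
    _ = infinitePi μ := (measurePreserving_piecewise μ {j}).map_eq

variable {μ} {X Y : (∀ i, Ω i) → ℝ}

lemma avg_singleton (hX : Measurable X) (j : ι) : avg μ {j} X = coordAvg μ X j := by
  ext ω
  simp only [avg, Finset.piecewise_singleton]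
  exact integral_comp_of_measurePreserving (measurePreserving_eval_infinitePi μ j)
    (F := fun u => X (Function.update ω j u)) (hX.comp (measurable_update ω)).aestronglyMeasurable

lemma measurable_coordAvg (hX : Measurable X) (j : ι) : Measurable (coordAvg μ X j) :=
  (StronglyMeasurable.integral_prod_right (f := fun ω u => X (Function.update ω j u)) (ν := μ j)
    (hX.comp measurable_update').stronglyMeasurable).measurable

lemma measurable_coordDiff (hX : Measurable X) (j : ι) :
    Measurable fun p : (∀ i, Ω i) × Ω j => coordDiff μ X j p.1 p.2 :=
  (hX.comp measurable_update').sub ((measurable_coordAvg hX j).comp measurable_fst)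

lemma integral_sub_coordAvg_mul (hX : Measurable X) (hY : Measurable Y) (j : ι) :
    ∫ ω, (X ω - coordAvg μ X j ω) * Y ω ∂infinitePi μ
      = ∫ p, coordDiff μ X j p.1 p.2 * Y (Function.update p.1 j p.2)
          ∂(infinitePi μ).prod (μ j) := by
  rw [← integral_comp_of_measurePreserving (measurePreserving_update μ j)
    (F := fun ω => (X ω - coordAvg μ X j ω) * Y ω)
    ((hX.sub (measurable_coordAvg hX j)).mul hY).aestronglyMeasurable]
  simp only [coordAvg_update, coordDiff]

variable (hX : Measurable X) (hX2 : MemLp X 2 (infinitePi μ)) (j : ι)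
include hX hX2

lemma memLp_coordAvg : MemLp (coordAvg μ X j) 2 (infinitePi μ) := by
  rw [← avg_singleton hX]
  exact memLp_avg {j} hX2

lemma memLp_coordDiff :
    MemLp (fun p : (∀ i, Ω i) × Ω j => coordDiff μ X j p.1 p.2) 2 ((infinitePi μ).prod (μ j)) :=
  (hX2.comp_measurePreserving (measurePreserving_update μ j)).sub
    ((memLp_coordAvg hX hX2 j).comp_measurePreserving measurePreserving_fst)

lemma ae_memLp_coordDiff : ∀ᵐ ω ∂infinitePi μ, MemLp (coordDiff μ X j ω) 2 (μ j) := by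
  filter_upwards [(memLp_coordDiff hX hX2 j).integrable_sq.prod_right_ae] with ω hω
  exact (memLp_two_iff_integrable_sq ((measurable_coordDiff hX j).comp
    measurable_prodMk_left).aestronglyMeasurable).2 hω

lemma ae_integral_coordDiff : ∀ᵐ ω ∂infinitePi μ, ∫ u, coordDiff μ X j ω u ∂μ j = 0 := by
  filter_upwards [ae_memLp_coordDiff hX hX2 j] with ω hω
  have hint : Integrable (fun u => X (Function.update ω j u)) (μ j) :=
    ((hω.integrable (by norm_num)).add (integrable_const (coordAvg μ X j ω))).congr
      (ae_of_all _ fun u => sub_add_cancel _ _)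
  simp only [coordDiff]
  rw [integral_sub hint (integrable_const _), integral_const, probReal_univ, one_smul, coordAvg,
    sub_self]

lemma integrable_coordVar : Integrable (coordVar μ X j) (infinitePi μ) :=
  (memLp_coordDiff hX hX2 j).integrable_sq.integral_prod_left

lemma integral_coordVar_eq : ∫ ω, coordVar μ X j ω ∂infinitePi μ
    = ∫ ω, (X ω - coordAvg μ X j ω) ^ 2 ∂infinitePi μ := by
  simp only [coordVar]
  rw [← integral_prod _ (memLp_coordDiff hX hX2 j).integrable_sq,
    ← integral_comp_of_measurePreserving (measurePreserving_update μ j)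
      (F := fun ω => (X ω - coordAvg μ X j ω) ^ 2)
      ((hX.sub (measurable_coordAvg hX j)).pow_const 2).aestronglyMeasurable]
  simp only [coordAvg_update, coordDiff]

lemma integral_coordDiff_mul (hY : MemLp Y 2 (infinitePi μ)) :
    ∫ p, coordDiff μ X j p.1 p.2 * Y p.1 ∂(infinitePi μ).prod (μ j) = 0 := by
  have hint : Integrable (fun p : (∀ i, Ω i) × Ω j => coordDiff μ X j p.1 p.2 * Y p.1)
      ((infinitePi μ).prod (μ j)) :=
    (memLp_coordDiff hX hX2 j).integrable_mul (hY.comp_measurePreserving measurePreserving_fst)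
  rw [integral_prod _ hint]
  refine integral_eq_zero_of_ae ?_
  filter_upwards [ae_integral_coordDiff hX hX2 j] with ω hω
  simp only [integral_mul_const, hω, zero_mul, Pi.zero_apply]

lemma integrable_coordDiff_mul_increment {C : ℝ} (hY : Measurable Y) (hYC : ∀ ω, |Y ω| ≤ C) :
    Integrable (fun p : (∀ i, Ω i) × Ω j =>
      coordDiff μ X j p.1 p.2 * (Y p.1 * (X (Function.update p.1 j p.2) - X p.1)))
      ((infinitePi μ).prod (μ j)) :=
  (memLp_coordDiff hX hX2 j).integrable_mul <|
    ((hX2.comp_measurePreserving (measurePreserving_update μ j)).sub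
      (hX2.comp_measurePreserving measurePreserving_fst)).of_le_mul (c := C)
      ((hY.comp measurable_fst).mul ((hX.comp measurable_update').sub
        (hX.comp measurable_fst))).aestronglyMeasurable
      (ae_of_all _ fun p => by
        rw [norm_mul]
        exact mul_le_mul_of_nonneg_right (hYC p.1) (norm_nonneg _))

lemma integral_coordDiff_mul_increment {C : ℝ} (hY : Measurable Y) (hYC : ∀ ω, |Y ω| ≤ C) :
    ∫ p, coordDiff μ X j p.1 p.2 * (Y p.1 * (X (Function.update p.1 j p.2) - X p.1))
        ∂(infinitePi μ).prod (μ j)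
      = ∫ ω, Y ω * coordVar μ X j ω ∂infinitePi μ := by
  rw [integral_prod _ (integrable_coordDiff_mul_increment hX hX2 j hY hYC)]
  refine integral_congr_ae ?_
  filter_upwards [ae_integral_coordDiff hX hX2 j, ae_memLp_coordDiff hX hX2 j] with ω hzero hω
  have hexpand : ∀ u, coordDiff μ X j ω u * (Y ω * (X (Function.update ω j u) - X ω))
      = Y ω * (coordDiff μ X j ω u ^ 2 - (X ω - coordAvg μ X j ω) * coordDiff μ X j ω u) :=
    fun u => by simp only [coordDiff]; ring
  simp only [hexpand]
  rw [integral_const_mul, integral_sub hω.integrable_sq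
    ((hω.integrable (by norm_num)).const_mul _), integral_const_mul, hzero, mul_zero, sub_zero,
    coordVar]

lemma lintegral_abs_coordDiff_mul_increment_sq :
    ∫⁻ p, ENNReal.ofReal
        (|coordDiff μ X j p.1 p.2| * (X (Function.update p.1 j p.2) - X p.1) ^ 2)
        ∂(infinitePi μ).prod (μ j)
      = ∫⁻ ω, coordRem μ X j ω ∂infinitePi μ := by
  have hF : Measurable fun p : (∀ i, Ω i) × Ω j => ENNReal.ofReal
      (|coordDiff μ X j p.1 p.2| * (X (Function.update p.1 j p.2) - X p.1) ^ 2) :=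
    ((measurable_coordDiff hX j).abs.mul (((hX.comp measurable_update').sub
      (hX.comp measurable_fst)).pow_const 2)).ennreal_ofReal
  rw [lintegral_prod _ hF.aemeasurable,
    ← (measurePreserving_update μ j).lintegral_comp hF.lintegral_prod_right',
    lintegral_prod]
  swap
  · exact (hF.lintegral_prod_right'.comp measurable_update').aemeasurable
  refine lintegral_congr_ae ?_
  filter_upwards [ae_integral_coordDiff hX hX2 j, ae_memLp_coordDiff hX hX2 j] with ω hzero hω
  have hincr : ∀ u v, X (Function.update ω j u) - X (Function.update ω j v)
      = coordDiff μ X j ω u - coordDiff μ X j ω v := fun u v => by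
    simp only [coordDiff, sub_sub_sub_cancel_right]
  have hd : Measurable (coordDiff μ X j ω) :=
    (measurable_coordDiff hX j).comp measurable_prodMk_left
  simp only [coordDiff_update, Function.update_idem, hincr]
  rw [lintegral_lintegral_swap (by simp only [Function.uncurry_def]; fun_prop),
    lintegral_lintegral_abs_mul_sub_sq hω hzero, coordRem]

/-- The factor `X - E_j X` is centred in the coordinate `j`, so the zeroth order term of the
Taylor expansion of `g` around `X` disappears. -/
lemma enorm_integral_sub_coordAvg_mul_comp_sub_le {g g' : ℝ → ℝ}
    (hg : Measurable g) (hg' : Measurable g') (hb : ∀ x, |g' x| ≤ 1)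
    (htaylor : ∀ x y, |g y - g x - (y - x) * g' x| ≤ (y - x) ^ 2)
    (hgX : MemLp (fun ω => g (X ω)) 2 (infinitePi μ)) :
    ‖(∫ ω, (X ω - coordAvg μ X j ω) * g (X ω) ∂infinitePi μ)
        - ∫ ω, g' (X ω) * coordVar μ X j ω ∂infinitePi μ‖ₑ
      ≤ ∫⁻ ω, coordRem μ X j ω ∂infinitePi μ := by
  have hd := memLp_coordDiff hX hX2 j
  have hupd : Integrable (fun p : (∀ i, Ω i) × Ω j =>
      coordDiff μ X j p.1 p.2 * g (X (Function.update p.1 j p.2))) ((infinitePi μ).prod (μ j)) :=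
    hd.integrable_mul (hgX.comp_measurePreserving (measurePreserving_update μ j))
  have hfst : Integrable (fun p : (∀ i, Ω i) × Ω j => coordDiff μ X j p.1 p.2 * g (X p.1))
      ((infinitePi μ).prod (μ j)) :=
    hd.integrable_mul (hgX.comp_measurePreserving measurePreserving_fst)
  have hsub : Integrable (fun p : (∀ i, Ω i) × Ω j =>
      coordDiff μ X j p.1 p.2 * g (X (Function.update p.1 j p.2))
        - coordDiff μ X j p.1 p.2 * g (X p.1)) ((infinitePi μ).prod (μ j)) := hupd.sub hfst
  have hlin : Integrable (fun p : (∀ i, Ω i) × Ω j => coordDiff μ X j p.1 p.2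
      * (g' (X p.1) * (X (Function.update p.1 j p.2) - X p.1))) ((infinitePi μ).prod (μ j)) :=
    integrable_coordDiff_mul_increment hX hX2 j (hg'.comp hX) fun ω => hb (X ω)
  have hremainder : (∫ ω, (X ω - coordAvg μ X j ω) * g (X ω) ∂infinitePi μ)
        - ∫ ω, g' (X ω) * coordVar μ X j ω ∂infinitePi μ
      = ∫ p, coordDiff μ X j p.1 p.2 * (g (X (Function.update p.1 j p.2)) - g (X p.1)
          - g' (X p.1) * (X (Function.update p.1 j p.2) - X p.1)) ∂(infinitePi μ).prod (μ j) := by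
    simp only [mul_sub (coordDiff μ X j _ _)]
    rw [integral_sub hsub hlin, integral_sub hupd hfst,
      integral_coordDiff_mul hX hX2 j hgX, sub_zero]
    exact congrArg₂ (· - ·) (integral_sub_coordAvg_mul hX (hg.comp hX) j)
      (integral_coordDiff_mul_increment hX hX2 j (hg'.comp hX) fun ω => hb (X ω)).symm
  rw [hremainder, ← lintegral_abs_coordDiff_mul_increment_sq hX hX2 j]
  refine (enorm_integral_le_lintegral_enorm _).trans (lintegral_mono fun p => ?_)
  rw [Real.enorm_eq_ofReal_abs, abs_mul, mul_comm (g' _)]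
  gcongr
  exact htaylor _ _

end Coordinate

/-! ### The Stein bound in a fixed chaos -/

section Integrals

variable {α : Type*} [MeasurableSpace α] {μ : Measure α}

lemma memLp_comp_of_lipschitzWith [IsFiniteMeasure μ] {p : ℝ≥0∞} {K : ℝ≥0} {g : ℝ → ℝ}
    (hg : LipschitzWith K g) {X : α → ℝ} (hX : MemLp X p μ) : MemLp (fun ω => g (X ω)) p μ := by
  have hshift : LipschitzWith K fun x => g x - g 0 := LipschitzWith.of_dist_le_mul fun x y => by
    simpa only [dist_sub_right] using hg.dist_le_mul x y
  exact ((hshift.comp_memLp (sub_self _) hX).add (memLp_const (g 0))).congr_norm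
    (hg.continuous.comp_aestronglyMeasurable hX.1) (ae_of_all _ fun ω => by simp)

lemma integrable_comp_of_lipschitzWith [IsFiniteMeasure μ] {K : ℝ≥0} {g : ℝ → ℝ}
    (hg : LipschitzWith K g) {X : α → ℝ} (hX : Integrable X μ) :
    Integrable (fun ω => g (X ω)) μ :=
  memLp_one_iff_integrable.1 (memLp_comp_of_lipschitzWith hg (memLp_one_iff_integrable.2 hX))

lemma wassersteinDist_le_of_differentiable {μ ν : Measure ℝ} [IsProbabilityMeasure μ]
    [IsProbabilityMeasure ν] (hμ : Integrable (fun x => x) μ) (hν : Integrable (fun x => x) ν)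
    {R : ℝ≥0∞}
    (hR : ∀ k : ℝ → ℝ, Differentiable ℝ k → LipschitzWith 1 k →
      ‖(∫ x, k x ∂μ) - ∫ x, k x ∂ν‖ₑ ≤ R) : wassersteinDist μ ν ≤ R := by
  refine iSup₂_le fun h hh => ENNReal.le_of_forall_pos_le_add fun ε hε _ => ?_
  obtain ⟨k, hkd, hk, hhk⟩ := exists_differentiable_lipschitzWith_approx hh
    (ε := ε / 2) (by positivity)
  have happrox : ∀ (ρ : Measure ℝ) [IsProbabilityMeasure ρ], Integrable (fun x => x) ρ →
      |(∫ x, h x ∂ρ) - ∫ x, k x ∂ρ| ≤ ε / 2 := fun ρ _ hρ => by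
    rw [← integral_sub (integrable_comp_of_lipschitzWith hh hρ)
      (integrable_comp_of_lipschitzWith hk hρ)]
    simpa using norm_integral_le_of_norm_le_const (μ := ρ) (f := fun x => h x - k x)
      (ae_of_all _ hhk)
  calc ENNReal.ofReal |(∫ x, h x ∂μ) - ∫ x, h x ∂ν|
      ≤ ENNReal.ofReal (|(∫ x, k x ∂μ) - ∫ x, k x ∂ν| + ε) := by
        refine ENNReal.ofReal_le_ofReal ?_
        have hμk := abs_le.1 (happrox μ hμ)
        have hνk := abs_le.1 (happrox ν hν)
        have hkk := abs_le.1 (le_refl |(∫ x, k x ∂μ) - ∫ x, k x ∂ν|)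
        rw [abs_le]
        constructor <;> linarith [hμk.1, hμk.2, hνk.1, hνk.2, hkk.1, hkk.2]
    _ = ‖(∫ x, k x ∂μ) - ∫ x, k x ∂ν‖ₑ + ε := by
        rw [ENNReal.ofReal_add (abs_nonneg _) ε.coe_nonneg, ENNReal.ofReal_coe_nnreal,
          Real.enorm_eq_ofReal_abs]
    _ ≤ R + ε := by
        gcongr
        exact hR k hkd hk

lemma enorm_integral_mul_le_lintegral_sq [IsProbabilityMeasure μ] {f W : α → ℝ}
    (hf : ∀ ω, |f ω| ≤ 1) (hW : AEStronglyMeasurable W μ) :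
    ‖∫ ω, f ω * W ω ∂μ‖ₑ ≤ (∫⁻ ω, ENNReal.ofReal (W ω ^ 2) ∂μ) ^ (1 / 2 : ℝ) :=
  calc ‖∫ ω, f ω * W ω ∂μ‖ₑ ≤ ∫⁻ ω, ‖f ω * W ω‖ₑ ∂μ := enorm_integral_le_lintegral_enorm _
    _ ≤ ∫⁻ ω, ‖W ω‖ₑ ∂μ := lintegral_mono fun ω => by
        rw [enorm_mul, Real.enorm_eq_ofReal_abs (f ω)]
        exact mul_le_of_le_one_left' (ENNReal.ofReal_le_one.2 (hf ω))
    _ = eLpNorm W 1 μ := eLpNorm_one_eq_lintegral_enorm.symm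
    _ ≤ eLpNorm W 2 μ := eLpNorm_le_eLpNorm_of_exponent_le one_le_two hW
    _ = (∫⁻ ω, ENNReal.ofReal (W ω ^ 2) ∂μ) ^ (1 / 2 : ℝ) := by
        rw [eLpNorm_eq_lintegral_rpow_enorm_toReal (by norm_num) (by norm_num)]
        simp [Real.enorm_eq_ofReal_abs, ← ENNReal.ofReal_pow]

variable {ι : Type*} {F : ι → α → ℝ} (hF : ∀ i, Integrable (F i) μ)
  (hF0 : ∀ i ω, 0 ≤ F i ω) (hsum : Summable fun i => ∫ ω, F i ω ∂μ)
include hF hF0 hsum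

lemma tsum_lintegral_ofReal_ne_top : ∑' i, ∫⁻ ω, ENNReal.ofReal (F i ω) ∂μ ≠ ∞ := by
  have hreal : ∀ i, ∫⁻ ω, ENNReal.ofReal (F i ω) ∂μ = ENNReal.ofReal (∫ ω, F i ω ∂μ) := fun i =>
    (ofReal_integral_eq_lintegral_ofReal (hF i) (ae_of_all _ (hF0 i))).symm
  simp only [hreal]
  exact hsum.tsum_ofReal_ne_top

variable [Countable ι]

lemma ae_summable_of_summable_integral : ∀ᵐ ω ∂μ, Summable fun i => F i ω := by
  have hnorm := summable_norm_of_tsum_eLpNorm_ne_top le_rfl (fun i => (hF i).1) <| by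
    simpa only [eLpNorm_one_eq_lintegral_enorm, Real.enorm_of_nonneg (hF0 _ _)]
      using tsum_lintegral_ofReal_ne_top hF hF0 hsum
  filter_upwards [hnorm] with ω hω using hω.of_norm

lemma integrable_tsum_of_summable_integral : Integrable (fun ω => ∑' i, F i ω) μ := by
  have hm : ∀ i, AEMeasurable (fun ω => ENNReal.ofReal (F i ω)) μ := fun i =>
    (hF i).1.aemeasurable.ennreal_ofReal
  have hint : Integrable (fun ω => (∑' i, ENNReal.ofReal (F i ω)).toReal) μ := by
    refine integrable_toReal_of_lintegral_ne_top (AEMeasurable.tsum hm) ?_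
    rw [lintegral_tsum hm]
    exact tsum_lintegral_ofReal_ne_top hF hF0 hsum
  refine hint.congr ?_
  filter_upwards [ae_summable_of_summable_integral hF hF0 hsum] with ω hω
  rw [← ENNReal.ofReal_tsum_of_nonneg (fun i => hF0 i ω) hω,
    ENNReal.toReal_ofReal (tsum_nonneg fun i => hF0 i ω)]

lemma hasSum_integral_mul {f : α → ℝ} {C : ℝ} (hf : AEStronglyMeasurable f μ)
    (hfC : ∀ ω, |f ω| ≤ C) :
    HasSum (fun i => ∫ ω, f ω * F i ω ∂μ) (∫ ω, f ω * ∑' i, F i ω ∂μ) := by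
  have hint : ∀ i, Integrable (fun ω => f ω * F i ω) μ := fun i =>
    (hF i).bdd_mul hf (ae_of_all _ hfC)
  have hbound : ∀ i, ∫ ω, ‖f ω * F i ω‖ ∂μ ≤ C * ∫ ω, F i ω ∂μ := fun i => by
    rw [← integral_const_mul]
    refine integral_mono (hint i).norm ((hF i).const_mul C) fun ω => ?_
    rw [norm_mul, Real.norm_of_nonneg (hF0 i ω)]
    exact mul_le_mul_of_nonneg_right (hfC ω) (hF0 i ω)
  simpa only [tsum_mul_left] using hasSum_integral_of_summable_integral_norm hint
    (Summable.of_nonneg_of_le (fun i => integral_nonneg fun _ => norm_nonneg _) hbound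
      (hsum.mul_left C))

end Integrals

section Chaos

open scoped InnerProductSpace
open MeasureTheory.Measure (infinitePi)

variable {ι : Type*} [DecidableEq ι] {Ω : ι → Type*} [∀ i, MeasurableSpace (Ω i)]
  {μ : ∀ i, Measure (Ω i)} [∀ i, IsProbabilityMeasure (μ i)]
  {X : (∀ i, Ω i) → ℝ} (hX : Measurable X) (hX2 : MemLp X 2 (infinitePi μ))
include hX

lemma sub_avgL_singleton_toLp (j : ι) :
    hX2.toLp - avgL μ {j} hX2.toLp = (hX2.sub (memLp_coordAvg hX hX2 j)).toLp := by
  rw [avgL_toLp, MemLp.toLp_sub hX2 (memLp_coordAvg hX hX2 j)]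
  congr 2
  exact avg_singleton hX j

lemma integral_coordVar_eq_norm_sq (j : ι) :
    ∫ ω, coordVar μ X j ω ∂infinitePi μ = ‖hX2.toLp - avgL μ {j} hX2.toLp‖ ^ 2 := by
  rw [integral_coordVar_eq hX hX2, sub_avgL_singleton_toLp hX hX2]
  exact (norm_toLp_sq (hX2.sub (memLp_coordAvg hX hX2 j))).symm

lemma norm_sub_avgL_comp_le {K : ℝ≥0} {g : ℝ → ℝ} (hg : LipschitzWith K g) (j : ι) :
    ‖(memLp_comp_of_lipschitzWith hg hX2).toLp
        - avgL μ {j} (memLp_comp_of_lipschitzWith hg hX2).toLp‖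
      ≤ K * ‖hX2.toLp - avgL μ {j} hX2.toLp‖ := by
  have hgX := memLp_comp_of_lipschitzWith hg hX2
  have hgA := memLp_comp_of_lipschitzWith hg (memLp_coordAvg hX hX2 j)
  have hfixed : avgL μ {j} hgA.toLp = hgA.toLp :=
    avgL_singleton_toLp_of_update hgA fun ω x => by rw [coordAvg_update]
  refine (norm_sub_apply_le_of_fixed (isSymmetricProjection_avgL μ {j}) _ hfixed).trans ?_
  rw [sub_avgL_singleton_toLp hX hX2, ← MemLp.toLp_sub]
  refine Lp.norm_le_mul_norm_of_ae_le_mul ?_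
  filter_upwards [(hgX.sub hgA).coeFn_toLp,
    (hX2.sub (memLp_coordAvg hX hX2 j)).coeFn_toLp] with ω hω hω'
  rw [hω, hω']
  exact abs_sub_le_of_lipschitzWith hg _ _

variable {n : ℕ} (hch : hX2.toLp ∈ chaos (fun j => avgL μ {j}) n)
include hch

lemma summable_integral_coordVar : Summable fun j => ∫ ω, coordVar μ X j ω ∂infinitePi μ := by
  simp only [integral_coordVar_eq_norm_sq hX hX2]
  exact summable_norm_sub_apply_sq (fun j => isSymmetricProjection_avgL μ {j}) hch

lemma hasSum_integral_sub_coordAvg_mul_comp {K : ℝ≥0} {g : ℝ → ℝ} (hg : LipschitzWith K g) :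
    HasSum (fun j => ∫ ω, (X ω - coordAvg μ X j ω) * g (X ω) ∂infinitePi μ)
      (n * ∫ ω, X ω * g (X ω) ∂infinitePi μ) := by
  have hE : ∀ j, (avgL μ {j}).IsSymmetricProjection := fun j => isSymmetricProjection_avgL μ {j}
  have hgX := memLp_comp_of_lipschitzWith hg hX2
  have hsummable : Summable fun j => ‖hgX.toLp - avgL μ {j} hgX.toLp‖ ^ 2 :=
    Summable.of_nonneg_of_le (fun _ => sq_nonneg _)
      (fun j => (pow_le_pow_left₀ (norm_nonneg _) (norm_sub_avgL_comp_le hX hX2 hg j) 2).trans_eq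
        (mul_pow _ _ 2))
      ((summable_norm_sub_apply_sq hE hch).mul_left _)
  have h := hasSum_inner_sub_apply hE hch hsummable
  simp only [sub_avgL_singleton_toLp hX hX2, inner_toLp_toLp] at h
  exact h

variable [Countable ι]

lemma integral_steinDeriv_sub_eq (hn : n ≠ 0) {K : ℝ≥0} {g g' : ℝ → ℝ} (hg : LipschitzWith K g)
    (hg' : Measurable g') (hb : ∀ x, |g' x| ≤ 1) :
    ∫ ω, (g' (X ω) - X ω * g (X ω)) ∂infinitePi μ
      = (∫ ω, g' (X ω) * (1 - 1 / (n : ℝ) * ∑' j, coordVar μ X j ω) ∂infinitePi μ)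
        - 1 / (n : ℝ) * ∑' j, ((∫ ω, (X ω - coordAvg μ X j ω) * g (X ω) ∂infinitePi μ)
            - ∫ ω, g' (X ω) * coordVar μ X j ω ∂infinitePi μ) := by
  have hV := integrable_tsum_of_summable_integral (integrable_coordVar hX hX2)
    (coordVar_nonneg μ X) (summable_integral_coordVar hX hX2 hch)
  have hg'X : AEStronglyMeasurable (fun ω => g' (X ω)) (infinitePi μ) :=
    (hg'.comp hX).aestronglyMeasurable
  have hg'i : Integrable (fun ω => g' (X ω)) (infinitePi μ) :=
    (integrable_const (1 : ℝ)).mono' hg'X (ae_of_all _ fun ω => hb (X ω))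
  have hg'V : Integrable (fun ω => g' (X ω) * ∑' j, coordVar μ X j ω) (infinitePi μ) :=
    hV.bdd_mul hg'X (ae_of_all _ fun ω => hb (X ω))
  have hXg : Integrable (fun ω => X ω * g (X ω)) (infinitePi μ) :=
    hX2.integrable_mul (memLp_comp_of_lipschitzWith hg hX2)
  have hexpand : ∀ ω, g' (X ω) * (1 - 1 / (n : ℝ) * ∑' j, coordVar μ X j ω)
      = g' (X ω) - 1 / (n : ℝ) * (g' (X ω) * ∑' j, coordVar μ X j ω) := fun ω => by ring
  simp only [hexpand]
  rw [integral_sub hg'i hXg, integral_sub hg'i (hg'V.const_mul _), integral_const_mul,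
    ((hasSum_integral_sub_coordAvg_mul_comp hX hX2 hch hg).sub (hasSum_integral_mul
      (integrable_coordVar hX hX2) (coordVar_nonneg μ X) (summable_integral_coordVar hX hX2 hch)
      hg'X fun ω => hb (X ω))).tsum_eq]
  field_simp
  ring

lemma enorm_integral_stein_le (hn : n ≠ 0) {K : ℝ≥0} {g g' : ℝ → ℝ} (hg : LipschitzWith K g)
    (hg' : Measurable g') (hb : ∀ x, |g' x| ≤ 1)
    (htaylor : ∀ x y, |g y - g x - (y - x) * g' x| ≤ (y - x) ^ 2) :
    ‖∫ ω, (g' (X ω) - X ω * g (X ω)) ∂infinitePi μ‖ₑ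
      ≤ (∫⁻ ω, ENNReal.ofReal ((1 - 1 / (n : ℝ) * ∑' j, coordVar μ X j ω) ^ 2) ∂infinitePi μ)
          ^ (1 / 2 : ℝ)
        + ENNReal.ofReal (1 / (n : ℝ)) * ∑' j, ∫⁻ ω, coordRem μ X j ω ∂infinitePi μ := by
  have hV := integrable_tsum_of_summable_integral (integrable_coordVar hX hX2)
    (coordVar_nonneg μ X) (summable_integral_coordVar hX hX2 hch)
  rw [integral_steinDeriv_sub_eq hX hX2 hch hn hg hg' hb]
  refine enorm_sub_le.trans (add_le_add ?_ ?_)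
  · exact enorm_integral_mul_le_lintegral_sq (fun ω => hb (X ω))
      (aestronglyMeasurable_const.sub (hV.const_mul _).1)
  · rw [enorm_mul, Real.enorm_of_nonneg (by positivity)]
    gcongr
    exact enorm_tsum_le_tsum_enorm.trans (ENNReal.tsum_le_tsum fun j =>
      enorm_integral_sub_coordAvg_mul_comp_sub_le hX hX2 j hg.continuous.measurable hg' hb htaylor
        (memLp_comp_of_lipschitzWith hg hX2))

lemma wassersteinDist_le_of_mem_chaos (hn : n ≠ 0) :
    wassersteinDist ((infinitePi μ).map X) (gaussianReal 0 1)
      ≤ (∫⁻ ω, ENNReal.ofReal ((1 - 1 / (n : ℝ) * ∑' j, coordVar μ X j ω) ^ 2) ∂infinitePi μ)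
          ^ (1 / 2 : ℝ)
        + ENNReal.ofReal (1 / (n : ℝ)) * ∑' j, ∫⁻ ω, coordRem μ X j ω ∂infinitePi μ := by
  have : IsProbabilityMeasure ((infinitePi μ).map X) :=
    Measure.isProbabilityMeasure_map hX.aemeasurable
  have hXi : Integrable X (infinitePi μ) := hX2.integrable one_le_two
  refine wassersteinDist_le_of_differentiable
    ((integrable_map_measure measurable_id.aestronglyMeasurable hX.aemeasurable).2 hXi)
    ((memLp_id_gaussianReal 1).integrable (by simp)) fun k hkd hk => ?_
  have hstein : (∫ x, k x ∂(infinitePi μ).map X) - ∫ x, k x ∂gaussianReal 0 1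
      = ∫ ω, (steinDeriv k (X ω) - X ω * steinSol k (X ω)) ∂infinitePi μ := by
    simp only [steinDeriv, add_sub_cancel_left]
    rw [integral_sub (integrable_comp_of_lipschitzWith hk hXi) (integrable_const _),
      integral_map hX.aemeasurable hk.continuous.aestronglyMeasurable]
    simp
  rw [hstein]
  refine enorm_integral_stein_le hX hX2 hch hn (K := 1) ?_
    (lipschitzWith_steinDeriv hk hkd).continuous.measurable
    (fun x => by simpa using abs_steinDeriv_le hk x) fun x y => ?_
  · refine lipschitzWith_of_nnnorm_deriv_le
      (fun x => (hasDerivAt_steinSol hk hkd x).differentiableAt) fun x => ?_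
    rw [(hasDerivAt_steinSol hk hkd x).deriv]
    exact abs_steinDeriv_le hk x
  · simpa using norm_sub_sub_smul_le_of_lipschitzWith_deriv (hasDerivAt_steinSol hk hkd)
      (lipschitzWith_steinDeriv hk hkd) x y

end Chaos

/-! ### The finite difference operator -/

lemma map_restrict_block (j : ℕ) :
    (volume.restrict (block j)).map (fun t => t - 2 * (j : ℝ) - 1) = (2 : ℝ≥0∞) • unif := by
  have hcomp : (fun t => t - 2 * (j : ℝ) - 1) ∘ (fun u => 2 * (j : ℝ) + 1 + u) = id :=
    funext fun u => by simp only [Function.comp_apply, id_eq]; ring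
  have hblock : volume.restrict (block j)
      = (2 : ℝ≥0∞) • unif.map fun u => 2 * (j : ℝ) + 1 + u := by
    rw [map_unif, smul_smul, ENNReal.mul_inv_cancel (by norm_num) (by norm_num), one_smul]
  rw [hblock, Measure.map_smul, Measure.map_map (by fun_prop) (by fun_prop), hcomp, Measure.map_id]

lemma measurableEmbedding_sub_sub (j : ℕ) :
    MeasurableEmbedding fun t : ℝ => t - 2 * (j : ℝ) - 1 :=
  (measurableEmbedding_subRight 1).comp (measurableEmbedding_subRight (2 * (j : ℝ)))

lemma setLIntegral_block (j : ℕ) (F : ℝ → ℝ≥0∞) :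
    ∫⁻ t in block j, F (t - 2 * (j : ℝ) - 1) = 2 * ∫⁻ u, F u ∂unif := by
  rw [← (measurableEmbedding_sub_sub j).lintegral_map, map_restrict_block, lintegral_smul_measure,
    smul_eq_mul]

lemma setIntegral_block (j : ℕ) (F : ℝ → ℝ) :
    ∫ t in block j, F (t - 2 * (j : ℝ) - 1) = 2 * ∫ u, F u ∂unif := by
  rw [← (measurableEmbedding_sub_sub j).integral_map, map_restrict_block, integral_smul_measure]
  simp

lemma ae_block (j : ℕ) {p : ℝ → Prop} (h : ∀ᵐ u ∂unif, p u) :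
    ∀ᵐ t ∂volume.restrict (block j), p (t - 2 * (j : ℝ) - 1) := by
  rw [← (measurableEmbedding_sub_sub j).ae_map_iff, map_restrict_block]
  exact Measure.ae_smul_measure h 2

lemma lintegral_leb (F : ℝ → ℝ≥0∞) : ∫⁻ t, F t ∂leb = ∑' j, ∫⁻ t in block j, F t := by
  rw [leb, ← iUnion_block]
  exact lintegral_iUnion measurableSet_block pairwise_disjoint_block F

lemma blockStart_nonneg (t : ℝ) : 0 ≤ blockStart t :=
  mul_nonneg zero_le_two (Nat.cast_nonneg _)

lemma blockStart_eq {j : ℕ} {t : ℝ} (ht : t ∈ block j) : blockStart t = 2 * (j : ℝ) := by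
  rw [blockStart, (mem_block_iff (block_subset_Ici j ht)).1 ht]

lemma Psi_eq {j : ℕ} {t : ℝ} (ht : t ∈ block j) (ω : Omega) :
    Psi t ω = Function.update ω j (t - 2 * (j : ℝ) - 1) := by
  rw [Psi, blockStart_eq ht, (mem_block_iff (block_subset_Ici j ht)).1 ht]

lemma nabla_eq {j : ℕ} {t : ℝ} (ht : t ∈ block j) (X : Omega → ℝ) (ω : Omega) :
    nabla X t ω = coordDiff (fun _ => unif) X j ω (t - 2 * (j : ℝ) - 1) := by
  have hmean : ∫ s in (2 * (j : ℝ))..(2 * (j : ℝ) + 2), X (Psi s ω)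
      = 2 * coordAvg (fun _ => unif) X j ω :=
    calc ∫ s in (2 * (j : ℝ))..(2 * (j : ℝ) + 2), X (Psi s ω)
        = ∫ s in block j, X (Psi s ω) := by
          rw [intervalIntegral.integral_of_le (by linarith), ← restrict_Ico_eq_restrict_Ioc, block]
      _ = ∫ s in block j, X (Function.update ω j (s - 2 * (j : ℝ) - 1)) :=
          setIntegral_congr_fun (measurableSet_block j) fun s hs => by simp only [Psi_eq hs]
      _ = 2 * coordAvg (fun _ => unif) X j ω :=
          setIntegral_block j fun u => X (Function.update ω j u)
  rw [nabla, coordDiff, blockStart_eq ht, hmean, Psi_eq ht]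
  ring

lemma setLIntegral_block_nabla (j : ℕ) (X : Omega → ℝ) (ω : Omega) (Φ : ℝ → ℝ≥0∞) :
    ∫⁻ t in block j, Φ (nabla X t ω) = 2 * ∫⁻ u, Φ (coordDiff (fun _ => unif) X j ω u) ∂unif :=
  (setLIntegral_congr_fun (measurableSet_block j) fun t ht => by simp only [nabla_eq ht]).trans
    (setLIntegral_block j fun u => Φ (coordDiff (fun _ => unif) X j ω u))

lemma setIntegral_block_nabla_sq (j : ℕ) (X : Omega → ℝ) (ω : Omega) :
    ∫ t in block j, nabla X t ω ^ 2 = 2 * coordVar (fun _ => unif) X j ω :=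
  (setIntegral_congr_fun (measurableSet_block j) fun t ht => by simp only [nabla_eq ht]).trans
    (setIntegral_block j fun u => coordDiff (fun _ => unif) X j ω u ^ 2)

lemma lintegral_nabla_cube (X : Omega → ℝ) (ω : Omega) :
    ∫⁻ t, ENNReal.ofReal (|nabla X t ω| ^ 3) ∂leb
      = ∑' j, 2 * ∫⁻ u, ENNReal.ofReal (|coordDiff (fun _ => unif) X j ω u| ^ 3) ∂unif := by
  rw [lintegral_leb]
  exact tsum_congr fun j => setLIntegral_block_nabla j X ω fun x => ENNReal.ofReal (|x| ^ 3)

lemma ae_nabla_eq {X Y : Omega → ℝ} (h : X =ᵐ[prob] Y) :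
    ∀ᵐ ω ∂prob, (fun t => nabla X t ω) =ᵐ[leb] fun t => nabla Y t ω := by
  have hupdate : ∀ᵐ ω ∂prob, ∀ j, ∀ᵐ u ∂unif,
      X (Function.update ω j u) = Y (Function.update ω j u) :=
    ae_all_iff.2 fun j => Measure.ae_ae_of_ae_prod
      ((measurePreserving_update (fun _ => unif) j).quasiMeasurePreserving.ae h)
  filter_upwards [hupdate] with ω hω
  rw [leb, ← iUnion_block, EventuallyEq, ae_restrict_iUnion_iff]
  intro j
  have havg : coordAvg (fun _ => unif) X j ω = coordAvg (fun _ => unif) Y j ω :=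
    integral_congr_ae (hω j)
  filter_upwards [ae_block j (hω j), ae_restrict_mem (measurableSet_block j)] with t ht htj
  rw [nabla_eq htj, nabla_eq htj, coordDiff, coordDiff, ht, havg]

section Measurable

variable {X : Omega → ℝ} (hX : Measurable X)
include hX

lemma measurable_coordDiff_apply (j : ℕ) (ω : Omega) :
    Measurable (coordDiff (fun _ => unif) X j ω) :=
  (measurable_coordDiff hX j).comp measurable_prodMk_left

lemma measurable_lintegral_comp_coordDiff (j : ℕ) {Φ : ℝ → ℝ≥0∞} (hΦ : Measurable Φ) :
    Measurable fun ω => ∫⁻ u, Φ (coordDiff (fun _ => unif) X j ω u) ∂unif :=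
  Measurable.lintegral_prod_right
    (f := fun (ω : Omega) u => Φ (coordDiff (fun _ => unif) X j ω u))
    (hΦ.comp (measurable_coordDiff hX j))

lemma lintegral_nabla_mul (ω : Omega) :
    ∫⁻ t, ENNReal.ofReal |nabla X t ω| *
        (∫⁻ s in Icc (blockStart t) (blockStart t + 2), ENNReal.ofReal (|nabla X s ω| ^ 2)) ∂leb
      = ∑' j, 4 * ((∫⁻ u, ENNReal.ofReal |coordDiff (fun _ => unif) X j ω u| ∂unif)
          * ∫⁻ u, ENNReal.ofReal (|coordDiff (fun _ => unif) X j ω u| ^ 2) ∂unif) := by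
  rw [lintegral_leb]
  refine tsum_congr fun j => ?_
  set B := ∫⁻ u, ENNReal.ofReal (|coordDiff (fun _ => unif) X j ω u| ^ 2) ∂unif
  have hblock : ∀ t ∈ block j, ∫⁻ s in Icc (blockStart t) (blockStart t + 2),
      ENNReal.ofReal (|nabla X s ω| ^ 2) = 2 * B := fun t ht => by
    rw [blockStart_eq ht, ← restrict_Ico_eq_restrict_Icc]
    exact setLIntegral_block_nabla j X ω fun x => ENNReal.ofReal (|x| ^ 2)
  have hm := measurable_coordDiff_apply hX j ω
  rw [setLIntegral_congr_fun (measurableSet_block j) fun t ht => by rw [hblock t ht],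
    setLIntegral_block_nabla j X ω fun x => ENNReal.ofReal |x| * (2 * B),
    lintegral_mul_const _ (by fun_prop)]
  ring

lemma lintegral_lintegral_nabla_cube :
    ∫⁻ ω, (∫⁻ t, ENNReal.ofReal (|nabla X t ω| ^ 3) ∂leb) ∂prob
      = 2 * ∑' j, ∫⁻ ω,
          (∫⁻ u, ENNReal.ofReal (|coordDiff (fun _ => unif) X j ω u| ^ 3) ∂unif) ∂prob := by
  have hm := fun j => measurable_lintegral_comp_coordDiff hX j
    (Φ := fun x => ENNReal.ofReal (|x| ^ 3)) (by fun_prop)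
  simp only [lintegral_nabla_cube]
  rw [lintegral_tsum fun j => ((hm j).const_mul 2).aemeasurable, ← ENNReal.tsum_mul_left]
  exact tsum_congr fun j => lintegral_const_mul _ (hm j)

lemma lintegral_lintegral_nabla_mul :
    ∫⁻ ω, (∫⁻ t, ENNReal.ofReal |nabla X t ω| *
        (∫⁻ s in Icc (blockStart t) (blockStart t + 2),
          ENNReal.ofReal (|nabla X s ω| ^ 2)) ∂leb) ∂prob
      = 4 * ∑' j, ∫⁻ ω, ((∫⁻ u, ENNReal.ofReal |coordDiff (fun _ => unif) X j ω u| ∂unif)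
          * ∫⁻ u, ENNReal.ofReal (|coordDiff (fun _ => unif) X j ω u| ^ 2) ∂unif) ∂prob := by
  have hm : ∀ j, Measurable fun ω =>
      (∫⁻ u, ENNReal.ofReal |coordDiff (fun _ => unif) X j ω u| ∂unif)
        * ∫⁻ u, ENNReal.ofReal (|coordDiff (fun _ => unif) X j ω u| ^ 2) ∂unif := fun j =>
    (measurable_lintegral_comp_coordDiff hX j
      (Φ := fun x => ENNReal.ofReal |x|) (by fun_prop)).mul
      (measurable_lintegral_comp_coordDiff hX j
        (Φ := fun x => ENNReal.ofReal (|x| ^ 2)) (by fun_prop))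
  simp only [lintegral_nabla_mul hX]
  rw [lintegral_tsum fun j => ((hm j).const_mul 4).aemeasurable, ← ENNReal.tsum_mul_left]
  exact tsum_congr fun j => lintegral_const_mul _ (hm j)

lemma tsum_lintegral_coordRem :
    ∑' j, ∫⁻ ω, coordRem (fun _ => unif) X j ω ∂prob
      = ∑' j, ∫⁻ ω,
          (∫⁻ u, ENNReal.ofReal (|coordDiff (fun _ => unif) X j ω u| ^ 3) ∂unif) ∂prob
        + ∑' j, ∫⁻ ω, ((∫⁻ u, ENNReal.ofReal |coordDiff (fun _ => unif) X j ω u| ∂unif)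
          * ∫⁻ u, ENNReal.ofReal (|coordDiff (fun _ => unif) X j ω u| ^ 2) ∂unif) ∂prob := by
  rw [← ENNReal.tsum_add]
  exact tsum_congr fun j => lintegral_add_left (measurable_lintegral_comp_coordDiff hX j
    (Φ := fun x => ENNReal.ofReal (|x| ^ 3)) (by fun_prop)) _

lemma ofReal_mul_tsum_lintegral_coordRem (c : ℝ) :
    ENNReal.ofReal (1 / c) * ∑' j, ∫⁻ ω, coordRem (fun _ => unif) X j ω ∂prob
      = ENNReal.ofReal (1 / (2 * c)) *
          (∫⁻ ω, (∫⁻ t, ENNReal.ofReal (|nabla X t ω| ^ 3) ∂leb) ∂prob)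
        + ENNReal.ofReal (1 / (4 * c)) *
          (∫⁻ ω, (∫⁻ t, ENNReal.ofReal |nabla X t ω| *
              (∫⁻ s in Icc (blockStart t) (blockStart t + 2),
                ENNReal.ofReal (|nabla X s ω| ^ 2)) ∂leb) ∂prob) := by
  have htwo : ENNReal.ofReal (1 / (2 * c)) * 2 = ENNReal.ofReal (1 / c) := by
    rw [← ENNReal.ofReal_ofNat, ← ENNReal.ofReal_mul' (by positivity)]
    ring_nf
  have hfour : ENNReal.ofReal (1 / (4 * c)) * 4 = ENNReal.ofReal (1 / c) := by
    rw [← ENNReal.ofReal_ofNat, ← ENNReal.ofReal_mul' (by positivity)]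
    ring_nf
  rw [lintegral_lintegral_nabla_cube hX, lintegral_lintegral_nabla_mul hX,
    tsum_lintegral_coordRem hX, mul_add, ← mul_assoc, ← mul_assoc, htwo, hfour]

lemma aestronglyMeasurable_nabla (ω : Omega) :
    AEStronglyMeasurable (fun t => nabla X t ω) leb := by
  rw [leb, ← iUnion_block, aestronglyMeasurable_iUnion_iff]
  intro j
  have hm : Measurable fun t : ℝ => coordDiff (fun _ => unif) X j ω (t - 2 * (j : ℝ) - 1) :=
    (measurable_coordDiff_apply hX j ω).comp (by fun_prop)
  refine hm.aestronglyMeasurable.congr ?_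
  filter_upwards [ae_restrict_mem (measurableSet_block j)] with t ht
  rw [nabla_eq ht]

end Measurable

section MeasurableChaos

variable {X : Omega → ℝ} (hX : Measurable X) (hX2 : MemLp X 2 prob) {n : ℕ}
  (hch : hX2.toLp ∈ uniformChaos n)
include hX hX2 hch

lemma ae_memLp_nabla_of_measurable : ∀ᵐ ω ∂prob, MemLp (fun t => nabla X t ω) 2 leb := by
  have hsummable : ∀ᵐ ω ∂prob, Summable fun j => coordVar (fun _ => unif) X j ω :=
    ae_summable_of_summable_integral (integrable_coordVar hX hX2) (coordVar_nonneg _ X)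
      (summable_integral_coordVar hX hX2 hch)
  filter_upwards [ae_all_iff.2 fun j => ae_memLp_coordDiff hX hX2 j, hsummable] with ω hω hsum
  have hblock : ∀ j, ∫⁻ t in block j, ENNReal.ofReal (nabla X t ω ^ 2)
      = ENNReal.ofReal (2 * coordVar (fun _ => unif) X j ω) := fun j => by
    rw [setLIntegral_block_nabla j X ω fun x => ENNReal.ofReal (x ^ 2), coordVar,
      ENNReal.ofReal_mul zero_le_two, ENNReal.ofReal_ofNat,
      ofReal_integral_eq_lintegral_ofReal (hω j).integrable_sq (ae_of_all _ fun _ => sq_nonneg _)]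
  have hm := aestronglyMeasurable_nabla hX ω
  refine (memLp_two_iff_integrable_sq hm).2 ⟨hm.pow 2, ?_⟩
  rw [hasFiniteIntegral_iff_ofReal (ae_of_all _ fun _ => sq_nonneg _), lintegral_leb]
  simp only [hblock]
  rw [← ENNReal.ofReal_tsum_of_nonneg
    (fun j => mul_nonneg zero_le_two (coordVar_nonneg _ X j ω)) (hsum.mul_left 2)]
  exact ENNReal.ofReal_lt_top

lemma ae_integral_nabla_sq : ∀ᵐ ω ∂prob,
    ∫ t, nabla X t ω ^ 2 ∂((1 / 2 : ℝ≥0) • leb) = ∑' j, coordVar (fun _ => unif) X j ω := by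
  filter_upwards [ae_memLp_nabla_of_measurable hX hX2 hch] with ω hω
  have hint : IntegrableOn (fun t => nabla X t ω ^ 2) (⋃ j, block j) volume := by
    rw [iUnion_block]
    exact hω.integrable_sq
  have hleb : ∫ t, nabla X t ω ^ 2 ∂leb = 2 * ∑' j, coordVar (fun _ => unif) X j ω := by
    rw [leb, ← iUnion_block, integral_iUnion measurableSet_block pairwise_disjoint_block hint,
      ← tsum_mul_left]
    exact tsum_congr fun j => setIntegral_block_nabla_sq j X ω
  rw [integral_smul_nnreal_measure, hleb, NNReal.smul_def, smul_eq_mul]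
  push_cast
  ring

end MeasurableChaos

/-- The right-hand side of the Malliavin–Stein bound for a random variable `X` in the `n`-th
chaos. -/
def steinBound (n : ℕ) (X : Omega → ℝ) : ℝ≥0∞ :=
  (∫⁻ ω, ENNReal.ofReal
      ((1 - 1 / (n : ℝ) * ∫ t, (nabla X t ω) ^ 2 ∂((1 / 2 : ℝ≥0) • leb)) ^ 2) ∂prob) ^ (1 / 2 : ℝ)
    + ENNReal.ofReal (1 / (2 * (n : ℝ))) *
      (∫⁻ ω, (∫⁻ t, ENNReal.ofReal (|nabla X t ω| ^ 3) ∂leb) ∂prob)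
    + ENNReal.ofReal (1 / (4 * (n : ℝ))) *
      (∫⁻ ω, (∫⁻ t, ENNReal.ofReal |nabla X t ω| *
          (∫⁻ s in Icc (blockStart t) (blockStart t + 2),
            ENNReal.ofReal (|nabla X s ω| ^ 2)) ∂leb) ∂prob)

lemma lintegral_mul_lintegral_Icc_blockStart_congr {a b : ℝ → ℝ} (h : a =ᵐ[leb] b) :
    ∫⁻ t, ENNReal.ofReal |a t| *
        (∫⁻ s in Icc (blockStart t) (blockStart t + 2), ENNReal.ofReal (|a s| ^ 2)) ∂leb
      = ∫⁻ t, ENNReal.ofReal |b t| *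
        (∫⁻ s in Icc (blockStart t) (blockStart t + 2), ENNReal.ofReal (|b s| ^ 2)) ∂leb := by
  have hinner : ∀ t, ∫⁻ s in Icc (blockStart t) (blockStart t + 2), ENNReal.ofReal (|a s| ^ 2)
      = ∫⁻ s in Icc (blockStart t) (blockStart t + 2), ENNReal.ofReal (|b s| ^ 2) := fun t => by
    have hsub : Icc (blockStart t) (blockStart t + 2) ⊆ Ici (0 : ℝ) := fun s hs =>
      (blockStart_nonneg t).trans hs.1
    refine lintegral_congr_ae ?_
    filter_upwards [ae_restrict_of_ae_restrict_of_subset hsub h] with s hs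
    rw [hs]
  simp only [hinner]
  refine lintegral_congr_ae ?_
  filter_upwards [h] with t ht
  rw [ht]

lemma steinBound_congr {X Y : Omega → ℝ} (h : X =ᵐ[prob] Y) (n : ℕ) :
    steinBound n X = steinBound n Y := by
  have hnabla := ae_nabla_eq h
  rw [steinBound, steinBound]
  congr 1
  · congr 2
    · refine lintegral_congr_ae ?_
      filter_upwards [hnabla] with ω hω
      have hsq : ∫ t, nabla X t ω ^ 2 ∂((1 / 2 : ℝ≥0) • leb)
          = ∫ t, nabla Y t ω ^ 2 ∂((1 / 2 : ℝ≥0) • leb) :=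
        integral_congr_ae <| (Measure.ae_smul_measure hω (1 / 2 : ℝ≥0)).mono fun t ht =>
          congrArg (· ^ 2) ht
      rw [hsq]
    · refine lintegral_congr_ae (hnabla.mono fun ω hω => lintegral_congr_ae ?_)
      exact hω.mono fun t ht => congrArg (fun x : ℝ => ENNReal.ofReal (|x| ^ 3)) ht
  · congr 1
    exact lintegral_congr_ae <| hnabla.mono fun ω hω =>
      lintegral_mul_lintegral_Icc_blockStart_congr hω

lemma wassersteinDist_le_steinBound_of_measurable {X : Omega → ℝ} (hX : Measurable X)
    (hX2 : MemLp X 2 prob) {n : ℕ} (hch : hX2.toLp ∈ uniformChaos n) (hn : n ≠ 0) :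
    wassersteinDist (prob.map X) (gaussianReal 0 1) ≤ steinBound n X := by
  have hvar : ∫⁻ ω, ENNReal.ofReal
        ((1 - 1 / (n : ℝ) * ∑' j, coordVar (fun _ => unif) X j ω) ^ 2) ∂prob
      = ∫⁻ ω, ENNReal.ofReal
        ((1 - 1 / (n : ℝ) * ∫ t, nabla X t ω ^ 2 ∂((1 / 2 : ℝ≥0) • leb)) ^ 2) ∂prob :=
    lintegral_congr_ae <| (ae_integral_nabla_sq hX hX2 hch).mono fun ω hω => by simp only [hω]
  refine (wassersteinDist_le_of_mem_chaos hX hX2 hch hn).trans_eq ?_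
  rw [steinBound, add_assoc, ← ofReal_mul_tsum_lintegral_coordRem hX, ← hvar]
  rfl

section Chaos

variable {X : Omega → ℝ} (hX : MemLp X 2 prob) {n : ℕ} (hch : hX.toLp ∈ uniformChaos n)
include hch

lemma exists_measurable_ae_eq_mem_uniformChaos :
    ∃ (Y : Omega → ℝ) (hY : MemLp Y 2 prob),
      Measurable Y ∧ X =ᵐ[prob] Y ∧ hY.toLp ∈ uniformChaos n := by
  obtain ⟨Y, hYm, hXY⟩ := hX.1.aemeasurable
  exact ⟨Y, hX.ae_eq hXY, hYm, hXY, MemLp.toLp_congr hX (hX.ae_eq hXY) hXY ▸ hch⟩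

lemma ae_memLp_nabla : ∀ᵐ ω ∂prob, MemLp (fun t => nabla X t ω) 2 leb := by
  obtain ⟨Y, hY, hYm, hXY, hYch⟩ := exists_measurable_ae_eq_mem_uniformChaos hX hch
  filter_upwards [ae_memLp_nabla_of_measurable hYm hY hYch, ae_nabla_eq hXY] with ω hω hXYω
  exact hω.ae_eq hXYω.symm

theorem wassersteinDist_le_steinBound (hn : n ≠ 0) :
    wassersteinDist (prob.map X) (gaussianReal 0 1) ≤ steinBound n X := by
  obtain ⟨Y, hY, hYm, hXY, hYch⟩ := exists_measurable_ae_eq_mem_uniformChaos hX hch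
  rw [Measure.map_congr hXY, steinBound_congr hXY]
  exact wassersteinDist_le_steinBound_of_measurable hYm hY hYch hn

end Chaos

lemma IsMultInt.toLp_mem_uniformChaos {n : ℕ} {f : (Fin n → ℝ) → ℝ} (hf : HatL2 n f)
    {X : Omega → ℝ} (hX : IsMultInt n f X) : hX.1.toLp ∈ uniformChaos n := by
  have heq : hX.1.toLp = multIntL n hf.memLp.toLp :=
    Lp.ext (hX.1.coeFn_toLp.trans ((isMultInt_iff hf).1 hX))
  exact heq ▸ multIntL_mem_uniformChaos _

end UniformSeq

end

theorem proposition3p4 (n : ℕ) (hn : 1 ≤ n) (f : (Fin n → ℝ) → ℝ) (hf : UniformSeq.HatL2 n f) :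
    -- `I_n(f)` is well defined, as an element of `L²(Ω)`
    (∃ X : UniformSeq.Omega → ℝ, UniformSeq.IsMultInt n f X) ∧
    (∀ X X' : UniformSeq.Omega → ℝ, UniformSeq.IsMultInt n f X → UniformSeq.IsMultInt n f X' →
      X =ᵐ[UniformSeq.prob] X') ∧
    ∀ X : UniformSeq.Omega → ℝ, UniformSeq.IsMultInt n f X →
      -- `∇ I_n(f)` is almost surely square-integrable, and the bound holds
      (∀ᵐ ω ∂UniformSeq.prob, MemLp (fun t => UniformSeq.nabla X t ω) 2 UniformSeq.leb) ∧
      UniformSeq.wassersteinDist (UniformSeq.prob.map X) (gaussianReal 0 1) ≤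
        (∫⁻ ω, ENNReal.ofReal
            ((1 - 1 / (n : ℝ) * ∫ t, (UniformSeq.nabla X t ω) ^ 2
              ∂((1 / 2 : ℝ≥0) • UniformSeq.leb)) ^ 2)
          ∂UniformSeq.prob) ^ (1 / 2 : ℝ)
        + ENNReal.ofReal (1 / (2 * (n : ℝ))) *
          (∫⁻ ω, (∫⁻ t, ENNReal.ofReal (|UniformSeq.nabla X t ω| ^ 3) ∂UniformSeq.leb)
            ∂UniformSeq.prob)
        + ENNReal.ofReal (1 / (4 * (n : ℝ))) *
          (∫⁻ ω, (∫⁻ t, ENNReal.ofReal |UniformSeq.nabla X t ω| *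
              (∫⁻ s in Icc (UniformSeq.blockStart t) (UniformSeq.blockStart t + 2),
                ENNReal.ofReal (|UniformSeq.nabla X s ω| ^ 2)) ∂UniformSeq.leb)
            ∂UniformSeq.prob) := by
  refine ⟨⟨_, (UniformSeq.isMultInt_iff hf).2 EventuallyEq.rfl⟩, fun X X' hX hX' => ?_,
    fun X hX => ?_⟩
  · exact ((UniformSeq.isMultInt_iff hf).1 hX).trans ((UniformSeq.isMultInt_iff hf).1 hX').symm
  · have hchaos : hX.1.toLp ∈ UniformSeq.uniformChaos n := hX.toLp_mem_uniformChaos hf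
    exact ⟨UniformSeq.ae_memLp_nabla hX.1 hchaos,
      UniformSeq.wassersteinDist_le_steinBound hX.1 hchaos (Nat.one_le_iff_ne_zero.1 hn)⟩
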